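/- Let $\tau:\mathbb R\to\mathbb R$ be an activation function such that (a) there are an open interval $I$ and $x_0\in I$ such that $\tau$ is three times differentiable on $I$ and $\tau''(x_0)\neq 0$, and (b) for every $\varepsilon>0$ there are affine maps $\rho_1,\rho_2:\mathbb R\to\mathbb R$ with $|(\rho_2\circ\tau\circ\rho_1)(x)-\max\{x,0\}|\le\varepsilon$ for all $x\in\mathbb R$. Setting. Let $D=(0,1)^2$. For an integer $n\ge 0$ let $V^{(n)}\subset H^1_0(D)$ be the P1 finite element space, with nodal hat functions $\lambda_i$ for the $n\times n$ inner nodes, on the uniform mesh that divides $[0,1]^2$ into $(n+1)^2$ equal squares, each cut along its diagonal of slope one. Let $n_1\ge 0$ and $n_{j+1}=2n_j+1$, and let $V_j=V^{(n_j)}$ with hat functions $\lambda^{(j)}_i$, so that $V_1\subset V_2\subset\cdots$. Let $P_j$ be the matrix of the embedding $V_j\subset V_{j+1}$ in the nodal bases, and let $(R_j^{\max}\mathbf u)_i=\max\{\mathbf u_{i'}:\operatorname{supp}\lambda^{(j+1)}_{i'}\subset\operatorname{supp}\lambda^{(j)}_i\}$. For $\boldsymbol\kappa\in\mathbb R^{\dim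 V_\ell}$ let $\kappa_h=\sum_i\boldsymbol\kappa_i\lambda^{(\ell)}_i$ and $(A_{\boldsymbol\kappa})_{ii'}=\int_D\kappa_h\langle\nabla\lambda^{(\ell)}_i,\nabla\lambda^{(\ell)}_{i'}\rangle\,dx$. Algorithm. Given $\omega>0$, a smoothing step for $(A,\mathbf f,\boldsymbol\varphi)$ is the projected Richardson step $\mathbf u\mapsto\max\{\mathbf u+\omega(\mathbf f-A\mathbf u),\boldsymbol\varphi\}$ (componentwise). The V-cycle with monotone restriction $\mathrm{VCMR}_{k,k_0,j}(\mathbf u,\mathbf f,A,\boldsymbol\varphi)$ consists, for $j=1$, of $k_0$ smoothing steps. For $j\ge 2$ it performs $k$ smoothing steps on $\mathbf u$, computes $\bar{\mathbf e}=\mathrm{VCMR}_{k,k_0,j-1}(0,\,P_{j-1}^\top(\mathbf f-A\mathbf u),\,P_{j-1}^\top AP_{j-1},\,R^{\max}_{j-1}(\boldsymbol\varphi-\mathbf u))$, replaces $\mathbf u$ by $\mathbf u+P_{j-1}\bar{\mathbf e}$, and performs $k$ further smoothing steps. Let $\mathrm{VCMR}^m_{k,k_0,\ell}(\mathbf u_0,\boldsymbol\kappa,\mathbf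 f,\boldsymbol\varphi)$ be the result of $m$ applications of $\mathrm{VCMR}_{k,k_0,\ell}(\cdot,\mathbf f,A_{\boldsymbol\kappa},\boldsymbol\varphi)$ to $\mathbf u_0$. Networks. A CNN is built by composition and by skip connections $x\mapsto(x,\Phi(x))$ (concatenation of channels) from multichannel convolutions with biases and zero padding, of stride one, of stride two ($(2n+1)\times(2n+1)\to n\times n$), or transposed of stride two ($n\times n\to(2n+1)\times(2n+1)$), each optionally followed by the componentwise application of $\tau$. Its number of weights $M(\Psi)$ is the total number of entries of all kernels and biases. Claim. There is a constant $C>0$ such that for all $n_1\ge 0$, $\omega,M,\varepsilon>0$ and all integers $k,m,\ell\ge 1$, $k_0\ge 0$ there is a CNN $\Psi:\mathbb R^{4\times\dim V_\ell}\to\mathbb R^{\dim V_\ell}$ with (i) $\|\Psi(\mathbf u_0,\boldsymbol\kappa,\mathbf f,\boldsymbol\varphi)-\mathrm{VCMR}^m_{k,k_0,\ell}(\mathbf u_0,\boldsymbol\kappa,\mathbf f,\boldsymbol\varphi)\|_{H^1(D)}\le\varepsilon$ for all $\mathbf u_0,\boldsymbol\kappa,\mathbf f,\boldsymbol\varphi\in[-M,M]^{\dim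 V_\ell}$, where coefficient vectors are identified with functions in $V_\ell$, and (ii) $M(\Psi)\le C\,m\,(k\ell+k_0)$. In particular, for fixed numbers $k,k_0$ of smoothing steps the number of weights is at most a constant times $m\ell$, where the constant does not depend on $m,\ell,M,\varepsilon,\omega$ or the mesh. -/

import Mathlib

open MeasureTheory

noncomputable section

namespace ObstacleCNN

/-! ### Activation functions and convolutional networks -/

/-- The assumption on the activation function: `τ` is three times differentiable on an open interval
around some `x₀` with `τ'' x₀ ≠ 0`, and `x ↦ max x 0` is uniformly approximated on `ℝ` by
`ρ₂ ∘ τ ∘ ρ₁` with affine `ρ₁`, `ρ₂`. -/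
structure IsAdmissibleActivation (τ : ℝ → ℝ) : Prop where
  smooth : ∃ x₀ a b : ℝ, x₀ ∈ Set.Ioo a b ∧
    (∀ j < 3, DifferentiableOn ℝ (iteratedDeriv j τ) (Set.Ioo a b)) ∧ iteratedDeriv 2 τ x₀ ≠ 0
  approx_max : ∀ ε : ℝ, 0 < ε → ∃ a₁ b₁ a₂ b₂ : ℝ, ∀ x : ℝ,
    |(a₂ * τ (a₁ * x + b₁) + b₂) - max x 0| ≤ ε

/-- The pixels of an `n × n` image. -/
abbrev Node (n : ℕ) : Type := Fin n × Fin n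

/-- Images of size `n × n` with `c` channels. -/
abbrev Image (c n : ℕ) : Type := Fin c → Node n → ℝ

/-- The kind of a convolution from `n × n` images to `n' × n'` images: size preserving (stride one),
two-strided, or transposed two-strided. -/
inductive Sampling : ℕ → ℕ → Type
  | same (n : ℕ) : Sampling n n
  | down (n : ℕ) : Sampling (2 * n + 1) n
  | up (n : ℕ) : Sampling n (2 * n + 1)

/-- The position, relative to the centre of the kernel, of the kernel entry that couples the input
coordinate `j` to the output coordinate `i`. The coarse pixel `i` sits at the fine pixel `2i+1`. -/
def Sampling.offset {n n' : ℕ} : Sampling n n' → ℤ → ℤ → ℤ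
  | .same _, j, i => j - i
  | .down _, j, i => j - (2 * i + 1)
  | .up _, j, i => i - (2 * j + 1)

/-- A convolution with `c` input and `c'` output channels, kernels of width and height
`2 * radius + 1`, and one bias for each output channel. -/
structure Conv (c n c' n' : ℕ) where
  sampling : Sampling n n'
  radius : ℕ
  kernel : Fin c' → Fin c → Fin (2 * radius + 1) → Fin (2 * radius + 1) → ℝ
  bias : Fin c' → ℝ

/-- The map defined by a convolution, with zero padding. -/
def Conv.eval {c n c' n' : ℕ} (L : Conv c n c' n') (x : Image c n) : Image c' n' := fun o i =>
  L.bias o + ∑ c₀ : Fin c, ∑ a : Fin (2 * L.radius + 1), ∑ b : Fin (2 * L.radius + 1), ∑ j : Node n,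
    if L.sampling.offset ((j.1 : ℕ) : ℤ) ((i.1 : ℕ) : ℤ) = ((a : ℕ) : ℤ) - (L.radius : ℤ) ∧
        L.sampling.offset ((j.2 : ℕ) : ℤ) ((i.2 : ℕ) : ℤ) = ((b : ℕ) : ℤ) - (L.radius : ℤ)
    then L.kernel o c₀ a b * x c₀ j else 0

/-- The number of entries of the kernels and of the bias. -/
def Conv.weights {c n c' n' : ℕ} (L : Conv c n c' n') : ℕ :=
  c' * c * (2 * L.radius + 1) ^ 2 + c'

/-- Convolutional neural networks (of U-net type): built from convolutions, with or without the
activation function behind them, by composition and by skip connections, which concatenate the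
channels of the input with those of the output of a network. -/
inductive CNN : ℕ → ℕ → ℕ → ℕ → Type
  | affine {c n c' n' : ℕ} (L : Conv c n c' n') : CNN c n c' n'
  | activated {c n c' n' : ℕ} (L : Conv c n c' n') : CNN c n c' n'
  | comp {c n c' n' c'' n'' : ℕ} (Ψ : CNN c' n' c'' n'') (Φ : CNN c n c' n') : CNN c n c'' n''
  | skip {c n c' : ℕ} (Φ : CNN c n c' n) : CNN c n (c + c') n

/-- The function realised by a network with activation function `τ`. -/
def CNN.eval (τ : ℝ → ℝ) {c n c' n' : ℕ} : CNN c n c' n' → Image c n → Image c' n'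
  | .affine L, x => L.eval x
  | .activated L, x => fun o i => τ (L.eval x o i)
  | .comp Ψ Φ, x => Ψ.eval τ (Φ.eval τ x)
  | .skip Φ, x => Fin.append x (Φ.eval τ x)

/-- The number of trainable parameters. -/
def CNN.weights {c n c' n' : ℕ} : CNN c n c' n' → ℕ
  | .affine L => L.weights
  | .activated L => L.weights
  | .comp Ψ Φ => Ψ.weights + Φ.weights
  | .skip Φ => Φ.weights

/-! ### P1 finite elements on a uniform mesh of the unit square -/

/-- The domain `D = (0,1)²`. -/
def unitSquare : Set (EuclideanSpace ℝ (Fin 2)) := {x | ∀ i, x i ∈ Set.Ioo (0 : ℝ) 1}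

/-- The hat function of the origin on the triangulation of the plane into the triangles with
vertices `z, z + (1,0), z + (1,1)` and `z, z + (0,1), z + (1,1)`, `z ∈ ℤ²`. -/
def refHat (s t : ℝ) : ℝ := max 0 (1 - max (max |s| |t|) |s - t|)

/-- `refHat` is `1` at the origin and `0` at all other integer points. -/
theorem refHat_int (a b : ℤ) : refHat a b = if a = 0 ∧ b = 0 then 1 else 0 := by
  split_ifs with h
  · simp [refHat, h.1, h.2]
  · have key : (1 : ℝ) ≤ max |(a : ℝ)| |(b : ℝ)| := by
      rw [le_max_iff]
      by_cases ha : a = 0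
      · right
        exact_mod_cast Int.one_le_abs fun hb => h ⟨ha, hb⟩
      · left
        exact_mod_cast Int.one_le_abs ha
    rw [refHat, max_eq_left]
    linarith [le_max_left (max |(a : ℝ)| |(b : ℝ)|) |(a : ℝ) - b|]

/-- The inner node `((i₁+1)h, (i₂+1)h)` of the uniform mesh with `n` inner nodes in each direction,
`h = 1/(n+1)`. -/
def node (n : ℕ) (i : Node n) : EuclideanSpace ℝ (Fin 2) :=
  !₂[(((i.1 : ℕ) : ℝ) + 1) / ((n : ℝ) + 1), (((i.2 : ℕ) : ℝ) + 1) / ((n : ℝ) + 1)]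

/-- The nodal hat function of the inner node `i`. The mesh cuts `[0,1]²` into `(n+1)²` squares and
each of these along its diagonal of slope one. -/
def hat (n : ℕ) (i : Node n) (x : EuclideanSpace ℝ (Fin 2)) : ℝ :=
  refHat (((n : ℝ) + 1) * x 0 - (((i.1 : ℕ) : ℝ) + 1)) (((n : ℝ) + 1) * x 1 - (((i.2 : ℕ) : ℝ) + 1))

/-- The finite element function `∑ i, v i • λ i` with coefficients `v`. -/
def feFun (n : ℕ) (v : Node n → ℝ) (x : EuclideanSpace ℝ (Fin 2)) : ℝ := ∑ i, v i * hat n i x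

/-- The norm of `H¹(D)` of the finite element function with coefficients `v`. Such functions are
piecewise affine, so their weak gradient is the gradient, which exists almost everywhere. -/
def h1Norm (n : ℕ) (v : Node n → ℝ) : ℝ :=
  √((∫ x in unitSquare, feFun n v x ^ 2) + ∫ x in unitSquare, ‖gradient (feFun n v) x‖ ^ 2)

/-- The discretised operator: entries `∫_D κ_h ⟨∇λ i, ∇λ j⟩`, with `κ_h` the finite element function
with coefficients `κ`. -/
def stiffness (n : ℕ) (κ : Node n → ℝ) : Matrix (Node n) (Node n) ℝ := Matrix.of fun i j =>
  ∫ x in unitSquare, feFun n κ x * inner ℝ (gradient (hat n i) x) (gradient (hat n j) x)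

/-! ### The multigrid algorithm -/

/-- The number of inner nodes in each direction after `r` uniform refinements of the mesh with `n₁`
inner nodes in each direction; the number `side n₁ r + 1` of squares doubles in each step. -/
def side (n₁ : ℕ) : ℕ → ℕ
  | 0 => n₁
  | r + 1 => 2 * side n₁ r + 1

/-- The matrix of the embedding of the coarse finite element space into the fine one. Its columns
hold the coefficients of the coarse hat functions, which are their values at the fine nodes. -/
def prolongation (n : ℕ) : Matrix (Node (2 * n + 1)) (Node n) ℝ :=
  Matrix.of fun j i => hat n i (node (2 * n + 1) j)

/-- The monotone restriction operator. -/
def monotoneRestriction (n : ℕ) (u : Node (2 * n + 1) → ℝ) : Node n → ℝ := fun i =>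
  ⨆ j : {j : Node (2 * n + 1) // tsupport (hat (2 * n + 1) j) ⊆ tsupport (hat n i)}, u j

/-- One step of the projected Richardson iteration. -/
def richardson {n : ℕ} (ω : ℝ) (A : Matrix (Node n) (Node n) ℝ) (f φ u : Node n → ℝ) : Node n → ℝ :=
  fun i => max (u i + ω * (f i - (A.mulVec u) i)) (φ i)

/-- One multigrid V-cycle with monotone restriction on `r + 1` levels, with right-hand side `f`,
obstacle `φ` and initial guess `u`: `k` pre- and `k` post-smoothing steps, and `k₀` smoothing steps
on the coarsest level. -/
def vcmr (n₁ k k₀ : ℕ) (ω : ℝ) : (r : ℕ) → (A : Matrix (Node (side n₁ r)) (Node (side n₁ r)) ℝ) →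
    (f φ u : Node (side n₁ r) → ℝ) → Node (side n₁ r) → ℝ
  | 0, A, f, φ, u => (richardson ω A f φ)^[k₀] u
  | r + 1, A, f, φ, u =>
    let P : Matrix (Node (side n₁ (r + 1))) (Node (side n₁ r)) ℝ := prolongation (side n₁ r)
    let u₁ := (richardson ω A f φ)^[k] u
    let φ' := monotoneRestriction (side n₁ r) (φ - u₁)
    let f' := P.transpose.mulVec (f - A.mulVec u₁)
    let A' := P.transpose * A * P
    let e := vcmr n₁ k k₀ ω r A' f' φ' 0
    (richardson ω A f φ)^[k] (u₁ + P.mulVec e)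

/-- `m` V-cycles for the discretised obstacle problem with coefficient `κ`, tested right-hand side
`f` and obstacle `φ`, starting from `u₀`, on `r + 1` levels. -/
def vcmrIter (n₁ k k₀ : ℕ) (ω : ℝ) (r m : ℕ) (u₀ κ f φ : Node (side n₁ r) → ℝ) :
    Node (side n₁ r) → ℝ :=
  (vcmr n₁ k k₀ ω r (stiffness (side n₁ r) κ) f φ)^[m] u₀

end ObstacleCNN

end

noncomputable section

namespace ObstacleCNN

/-! ### Convolutions with kernels of width three -/

/-! A V-cycle is a composition of simple maps on images whose twelve channels hold the iterate, the
right-hand side, the obstacle and the nine-point stencils of the operator. Storing the stencils as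
channels is necessary because the coefficient is an input and the operator therefore varies. Three
structural facts turn every step into convolutions of width three and pointwise operations. The
stencils depend on the coefficient through a translation invariant convolution
(`stiffness_eq_stencilMatrix`). The Galerkin product of a nine-point operator is again nine-point,
with stencils given by a two-strided convolution (`galerkin_product`). The monotone restriction is a
maximum of nine shifted samples (`monotoneRestriction_eq_sup'`).

The nonlinear ingredients are products, needed to apply the operator, and maxima. Products come from
squares by polarisation, and squares from a scaled second difference of `τ` at a point with nonzero
second derivative. Maxima come from the assumed approximation of `max x 0`.

`NetApprox` avoids any quantitative error propagation. It asks for continuity and for approximation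
on each bounded set to any accuracy with one fixed weight budget. Uniform continuity on compact sets
makes this stable under composition, and the budgets add. Kernel sizes do not depend on the image
size, so a smoothing step or a grid transfer costs an absolute constant, and induction over the
levels gives the count. Mesh-dependent constants, such as the one comparing coefficients with the
`H¹` norm, affect only the required accuracy and never the number of weights. -/

/-- The position of the fine or coarse pixel `j` relative to `i`. -/
def Sampling.offset₂ {n n' : ℕ} (S : Sampling n n') (j : Node n) (i : Node n') : ℤ × ℤ :=
  (S.offset ((j.1 : ℕ) : ℤ) ((i.1 : ℕ) : ℤ), S.offset ((j.2 : ℕ) : ℤ) ((i.2 : ℕ) : ℤ))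

/-- The positions in a kernel of width three. -/
abbrev Dir : Type := ↥(Finset.Icc (-1 : ℤ × ℤ) 1)

theorem mem_Icc_iff (s : ℤ × ℤ) :
    s ∈ Finset.Icc (-1 : ℤ × ℤ) 1 ↔ (-1 ≤ s.1 ∧ s.1 ≤ 1) ∧ -1 ≤ s.2 ∧ s.2 ≤ 1 := by
  rw [Finset.mem_Icc, Prod.le_def, Prod.le_def]
  simp only [Prod.fst_neg, Prod.snd_neg, Prod.fst_one, Prod.snd_one]
  tauto

/-- The convolution with kernel `K`, restricted to positions of size at most one. -/
def Conv.ofKernel {c n c' n' : ℕ} (S : Sampling n n') (K : Fin c' → Fin c → ℤ × ℤ → ℝ)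
    (b : Fin c' → ℝ) : Conv c n c' n' :=
  ⟨S, 1, fun o c₀ p q => K o c₀ (((p : ℕ) : ℤ) - 1, ((q : ℕ) : ℤ) - 1), b⟩

theorem sum_kernel_ite (K : ℤ × ℤ → ℝ) (hK : ∀ s, s ∉ Finset.Icc (-1 : ℤ × ℤ) 1 → K s = 0)
    (p q : ℤ) (y : ℝ) :
    ∑ a : Fin 3, ∑ b : Fin 3, (if p = ((a : ℕ) : ℤ) - 1 ∧ q = ((b : ℕ) : ℤ) - 1
      then K (((a : ℕ) : ℤ) - 1, ((b : ℕ) : ℤ) - 1) * y else 0) = K (p, q) * y := by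
  by_cases h : (p, q) ∈ Finset.Icc (-1 : ℤ × ℤ) 1
  · obtain ⟨⟨h1, h2⟩, h3, h4⟩ := (mem_Icc_iff _).1 h
    simp only at h1 h2 h3 h4
    interval_cases p <;> interval_cases q <;> simp [Fin.sum_univ_three]
  · rw [hK _ h, zero_mul]
    refine Finset.sum_eq_zero fun a _ => Finset.sum_eq_zero fun b _ => ?_
    rw [if_neg]
    rintro ⟨rfl, rfl⟩
    refine h ((mem_Icc_iff _).2 ?_)
    have := a.2
    have := b.2
    simp only
    omega

theorem Conv.ofKernel_eval {c n c' n' : ℕ} (S : Sampling n n') (K : Fin c' → Fin c → ℤ × ℤ → ℝ)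
    (hK : ∀ o c₀ s, s ∉ Finset.Icc (-1 : ℤ × ℤ) 1 → K o c₀ s = 0) (b : Fin c' → ℝ)
    (x : Image c n) (o : Fin c') (i : Node n') :
    (Conv.ofKernel S K b).eval x o i = b o + ∑ c₀, ∑ j, K o c₀ (S.offset₂ j i) * x c₀ j := by
  unfold Conv.eval
  congr 1
  refine Finset.sum_congr rfl fun c₀ _ => ?_
  simp only [Conv.ofKernel]
  calc _ = ∑ j : Node n, ∑ p : Fin 3, ∑ q : Fin 3, _ := by
        rw [Finset.sum_comm]
        rw [Finset.sum_comm (γ := Node n)]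
        refine Finset.sum_congr rfl fun q _ => ?_
        exact Finset.sum_comm
    _ = _ := Finset.sum_congr rfl fun j _ => ?_
  rw [Finset.sum_comm]
  exact sum_kernel_ite _ (hK o c₀) _ _ (x c₀ j)

theorem Conv.ofKernel_weights {c n c' n' : ℕ} (S : Sampling n n')
    (K : Fin c' → Fin c → ℤ × ℤ → ℝ) (b : Fin c' → ℝ) :
    (Conv.ofKernel S K b).weights = c' * c * 9 + c' := rfl

/-! ### Maps that are approximated by networks with a bounded number of weights -/

/-- `F` is continuous, and on bounded sets it is the uniform limit of networks with at most `W`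
weights. The channels are indexed by arbitrary finite types. -/
def NetApprox (τ : ℝ → ℝ) (W : ℕ) {α β : Type} {n n' : ℕ}
    (F : (α → Node n → ℝ) → β → Node n' → ℝ) : Prop :=
  Continuous F ∧ ∀ M ε : ℝ, 0 < ε → ∀ {c c' : ℕ} (eα : α ≃ Fin c) (eβ : β ≃ Fin c'),
    ∃ Ψ : CNN c n c' n', Ψ.weights ≤ W ∧ ∀ x : α → Node n → ℝ, (∀ a i, |x a i| ≤ M) →
      ∀ b i, |Ψ.eval τ (fun o => x (eα.symm o)) (eβ b) i - F x b i| ≤ ε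

variable {τ : ℝ → ℝ} {α β γ : Type} {n n' n'' : ℕ}

theorem NetApprox.mono {W W' : ℕ} {F : (α → Node n → ℝ) → β → Node n' → ℝ}
    (hF : NetApprox τ W F) (h : W ≤ W') : NetApprox τ W' F :=
  ⟨hF.1, fun M ε hε _ _ eα eβ =>
    let ⟨Ψ, h1, h2⟩ := hF.2 M ε hε eα eβ
    ⟨Ψ, h1.trans h, h2⟩⟩

theorem NetApprox.congr {W : ℕ} {F G : (α → Node n → ℝ) → β → Node n' → ℝ}
    (hF : NetApprox τ W F) (h : ∀ x b i, G x b i = F x b i) : NetApprox τ W G := by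
  have : G = F := by
    funext x b i
    exact h x b i
  rwa [this]

theorem norm_image_le [Fintype α] {M : ℝ} (hM : 0 ≤ M) (x : α → Node n → ℝ) :
    ‖x‖ ≤ M ↔ ∀ a i, |x a i| ≤ M := by
  simp [pi_norm_le_iff_of_nonneg hM]

/-- `F` maps the ball of inputs into some ball, and `G` is uniformly continuous on a slightly larger
one. Hence a sufficiently accurate network for `F` followed by a network for `G` on the larger ball
works. -/
theorem NetApprox.comp [Finite α] [Finite β] {W₁ W₂ : ℕ}
    {G : (β → Node n' → ℝ) → γ → Node n'' → ℝ} {F : (α → Node n → ℝ) → β → Node n' → ℝ}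
    (hG : NetApprox τ W₂ G) (hF : NetApprox τ W₁ F) :
    NetApprox τ (W₂ + W₁) fun x => G (F x) := by
  have := Fintype.ofFinite α
  have := Fintype.ofFinite β
  refine ⟨hG.1.comp hF.1, fun M ε hε c c'' eα eγ => ?_⟩
  obtain ⟨M', hM'⟩ := ((isCompact_closedBall (0 : α → Node n → ℝ) |M|).image hF.1).isBounded.exists_norm_le
  have huc := (isCompact_closedBall (0 : β → Node n' → ℝ) (|M'| + 1)).uniformContinuousOn_of_continuous
    (f := fun y (p : γ × Node n'') => G y p.1 p.2) (by
      have := hG.1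
      fun_prop)
  have : Fintype γ := Fintype.ofEquiv _ eγ.symm
  obtain ⟨δ, hδ, hG'⟩ := Metric.uniformContinuousOn_iff.1 huc (ε / 2) (half_pos hε)
  -- The bound `1` keeps the perturbed intermediate image in the ball of radius `|M'| + 1`, where
  -- `Ψ` is accurate. The bound `δ / 2` makes the strict inequality of uniform continuity available.
  obtain ⟨Φ, hΦw, hΦ⟩ := hF.2 M (min (δ / 2) 1) (by positivity) eα (Fintype.equivFin β)
  obtain ⟨Ψ, hΨw, hΨ⟩ := hG.2 (|M'| + 1) (ε / 2) (half_pos hε) (Fintype.equivFin β) eγ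
  refine ⟨.comp Ψ Φ, Nat.add_le_add hΨw hΦw, fun x hx b i => ?_⟩
  have hFx : ‖F x‖ ≤ |M'| := (hM' _ ⟨x, by
    rw [mem_closedBall_zero_iff, norm_image_le (abs_nonneg _)]
    exact fun a i => (hx a i).trans (le_abs_self M), rfl⟩).trans (le_abs_self _)
  set y : β → Node n' → ℝ := fun b =>
    Φ.eval τ (fun o => x (eα.symm o)) (Fintype.equivFin β b) with hy
  have hyF : ‖y - F x‖ ≤ min (δ / 2) 1 := (norm_image_le (by positivity) _).2 (hΦ x hx)
  have hy1 : ‖y‖ ≤ |M'| + 1 := by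
    calc ‖y‖ = ‖F x + (y - F x)‖ := by congr 1; abel
      _ ≤ ‖F x‖ + ‖y - F x‖ := norm_add_le _ _
      _ ≤ _ := add_le_add hFx (hyF.trans (min_le_right _ _))
  have h1 := hΨ y ((norm_image_le (by positivity) _).1 hy1) b i
  have h2 := hG' y (by simpa using hy1) (F x) (by simpa using by linarith) (by
    rw [dist_eq_norm]
    exact hyF.trans_lt ((min_le_left _ _).trans_lt (half_lt_self hδ)))
  have h3 : |G y b i - G (F x) b i| < ε / 2 :=
    (dist_le_pi_dist (fun p : γ × Node n'' => G y p.1 p.2) _ (b, i)).trans_lt h2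
  have h4 : CNN.eval τ (.comp Ψ Φ) (fun o => x (eα.symm o)) =
      Ψ.eval τ (fun o => y ((Fintype.equivFin β).symm o)) := by
    simp [CNN.eval, hy]
  rw [h4]
  calc _ ≤ _ := abs_sub_le _ (G y b i) _
    _ ≤ ε := by linarith

theorem NetApprox.conv [Fintype α] [Fintype β] (S : Sampling n n') (K : β → α → ℤ × ℤ → ℝ)
    (hK : ∀ b a s, s ∉ Finset.Icc (-1 : ℤ × ℤ) 1 → K b a s = 0) (z : β → ℝ) :
    NetApprox τ (Fintype.card β * Fintype.card α * 9 + Fintype.card β)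
      fun x b i => z b + ∑ a, ∑ j, K b a (S.offset₂ j i) * x a j := by
  refine ⟨by fun_prop, fun M ε hε c c' eα eβ => ?_⟩
  have hc : Fintype.card α = c := by simpa using Fintype.card_congr eα
  have hc' : Fintype.card β = c' := by simpa using Fintype.card_congr eβ
  refine ⟨.affine (.ofKernel S (fun o c₀ => K (eβ.symm o) (eα.symm c₀)) fun o => z (eβ.symm o)),
    ?_, fun x _ b i => ?_⟩
  · rw [CNN.weights, Conv.ofKernel_weights, hc, hc']
  · rw [CNN.eval, Conv.ofKernel_eval _ _ (fun _ _ => hK _ _), eβ.symm_apply_apply,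
      Equiv.sum_comp eα.symm fun a => ∑ j, K b a (S.offset₂ j i) * x a j]
    simpa using hε.le

theorem sum_same_offset (w : ℝ) (v : Node n → ℝ) (i : Node n) :
    ∑ j, (if (Sampling.same n).offset₂ j i = 0 then w else 0) * v j = w * v i := by
  rw [Finset.sum_eq_single i]
  · simp [Sampling.offset₂, Sampling.offset]
  · intro j _ hj
    rw [if_neg, zero_mul]
    intro h
    apply hj
    simp only [Sampling.offset₂, Sampling.offset, Prod.mk_eq_zero] at h
    ext <;> omega
  · simp

theorem NetApprox.pointwiseLinear [Fintype α] [Fintype β] (w : β → α → ℝ) (z : β → ℝ) :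
    NetApprox τ (Fintype.card β * Fintype.card α * 9 + Fintype.card β)
      fun (x : α → Node n → ℝ) b i => z b + ∑ a, w b a * x a i := by
  refine (NetApprox.conv (.same n) (fun b a s => if s = 0 then w b a else 0) ?_ z).congr ?_
  · intro b a s hs
    rw [if_neg]
    rintro rfl
    exact hs (by decide)
  · intro x b i
    simp only [sum_same_offset]

theorem NetApprox.reindex [Fintype α] [Fintype β] (g : β → α) :
    NetApprox τ (Fintype.card β * Fintype.card α * 9 + Fintype.card β)
      fun (x : α → Node n → ℝ) b => x (g b) := by
  classical
  refine (NetApprox.pointwiseLinear (fun b a => if a = g b then 1 else 0) 0).congr ?_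
  intro x b i
  simp

theorem NetApprox.skip [Fintype α] [Fintype β] {W : ℕ} {F : (α → Node n → ℝ) → β → Node n → ℝ}
    (hF : NetApprox τ W F) :
    NetApprox τ (((Fintype.card α + Fintype.card β) * (Fintype.card α + Fintype.card β) * 9 +
      (Fintype.card α + Fintype.card β)) + W) fun x => Sum.elim x (F x) := by
  refine ⟨by
    have := hF.1
    refine continuous_pi fun s => ?_
    rcases s with a | b
    · exact continuous_apply a
    · exact (continuous_apply b).comp this, fun M ε hε c c' eα e => ?_⟩
  obtain ⟨Φ, hΦw, hΦ⟩ := hF.2 M ε hε eα (Fintype.equivFin β)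
  have hc : Fintype.card α = c := by simpa using Fintype.card_congr eα
  have hc' : Fintype.card α + Fintype.card β = c' := by simpa using Fintype.card_congr e
  let e' : Fin c' ≃ Fin (c + Fintype.card β) :=
    e.symm.trans ((eα.sumCongr (Fintype.equivFin β)).trans finSumFinEquiv)
  -- The numbering `e` of the output channels is arbitrary, whereas a skip connection puts the input
  -- first. A permutation of the channels, written as a convolution, reconciles the two.
  refine ⟨.comp (.affine (.ofKernel (.same n)
    (fun o q s => if s = 0 then (if q = e' o then 1 else 0) else 0) 0)) (.skip Φ), ?_, ?_⟩
  · simp only [CNN.weights, Conv.ofKernel_weights]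
    rw [hc', show c + Fintype.card β = c' by omega]
    omega
  · intro x hx b i
    rw [CNN.eval, CNN.eval, Conv.ofKernel_eval]
    · simp only [sum_same_offset]
      have h0 : ∀ y : Fin (c + Fintype.card β) → Node n → ℝ,
          (0 : Fin c' → ℝ) (e b) + ∑ q, (if q = e' (e b) then 1 else 0) * y q i = y (e' (e b)) i := by
        intro y
        simp
      rw [h0]
      rcases b with a | b
      · simp [e', CNN.eval, hε.le]
      · simpa [e', CNN.eval] using hΦ x hx b i
    · intro o q s hs
      rw [if_neg]
      rintro rfl
      exact hs (by decide)

/-- Parallel branches reduce to skip connections: append `F x` to the input, append `G` of the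
retained input, then discard the input channels. -/
theorem NetApprox.pair [Fintype α] [Fintype β] [Fintype γ] {W₁ W₂ : ℕ}
    {F : (α → Node n → ℝ) → β → Node n → ℝ} {G : (α → Node n → ℝ) → γ → Node n → ℝ}
    (hF : NetApprox τ W₁ F) (hG : NetApprox τ W₂ G) :
    NetApprox τ (W₁ + W₂ + 40 * (Fintype.card α + Fintype.card β + Fintype.card γ + 1) ^ 2)
      fun x => Sum.elim (F x) (G x) := by
  have h1 := (hG.comp (NetApprox.reindex (τ := τ) (n := n) (Sum.inl : α → α ⊕ β))).skip.comp hF.skip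
  have h2 := (NetApprox.reindex (τ := τ) (n := n) (α := (α ⊕ β) ⊕ γ)
    (Sum.elim (fun b => Sum.inl (Sum.inr b)) Sum.inr : β ⊕ γ → (α ⊕ β) ⊕ γ)).comp h1
  refine (h2.congr (G := fun x => Sum.elim (F x) (G x)) ?_).mono ?_
  · rintro x (b | b) i <;> rfl
  · simp only [Fintype.card_sum]
    generalize Fintype.card α = a
    generalize Fintype.card β = b
    generalize Fintype.card γ = c
    nlinarith [Nat.zero_le (a * b), Nat.zero_le (a * c), Nat.zero_le (b * c)]

/-- `x ↦ s • F x + t • G x`. -/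
theorem NetApprox.linComb [Fintype α] [Fintype β] {W₁ W₂ : ℕ}
    {F G : (α → Node n → ℝ) → β → Node n → ℝ} (hF : NetApprox τ W₁ F) (hG : NetApprox τ W₂ G)
    (s t : ℝ) :
    NetApprox τ (Fintype.card β * Fintype.card (β ⊕ β) * 9 + Fintype.card β +
      (W₁ + W₂ + 40 * (Fintype.card α + Fintype.card β + Fintype.card β + 1) ^ 2))
      fun x b i => s * F x b i + t * G x b i := by
  classical
  refine ((NetApprox.pointwiseLinear (τ := τ) (n := n) (α := β ⊕ β) (β := β) (fun b => Sum.elim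
    (fun a => if a = b then s else 0) fun a => if a = b then t else 0) 0).comp (hF.pair hG)).congr ?_
  intro x b i
  simp

/-! ### Nonlinear pointwise operations -/

/-- Functions that are approximated on bounded intervals by shallow networks with `N` neurons. -/
def ShallowApprox (τ : ℝ → ℝ) (N : ℕ) (g : ℝ → ℝ) : Prop :=
  ∀ M ε : ℝ, 0 < ε → ∃ (w z v : Fin N → ℝ) (z₀ : ℝ), ∀ x : ℝ, |x| ≤ M →
    |z₀ + ∑ q, v q * τ (w q * x + z q) - g x| ≤ ε

theorem IsAdmissibleActivation.shallowApprox_max (hτ : IsAdmissibleActivation τ) :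
    ShallowApprox τ 1 fun x => max x 0 := by
  intro M ε hε
  obtain ⟨a₁, b₁, a₂, b₂, h⟩ := hτ.approx_max ε hε
  refine ⟨fun _ => a₁, fun _ => b₁, fun _ => a₂, b₂, fun x _ => ?_⟩
  simpa [add_comm] using h x

/-- The mean value inequality is applied to `τ (x₀ + y) + τ (x₀ - y) - y ^ 2 * T`. Its derivative is
the difference of the first-order remainders of `τ'` at `y` and `-y`, hence `o(y)`. -/
theorem exists_second_difference {x₀ a b : ℝ} (hx₀ : x₀ ∈ Set.Ioo a b)
    (hd : ∀ j < 3, DifferentiableOn ℝ (iteratedDeriv j τ) (Set.Ioo a b)) {η : ℝ} (hη : 0 < η) :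
    ∃ δ > 0, ∀ t : ℝ, |t| ≤ δ →
      |τ (x₀ + t) + τ (x₀ - t) - 2 * τ x₀ - t ^ 2 * iteratedDeriv 2 τ x₀| ≤ η * t ^ 2 := by
  have hnhds : Set.Ioo a b ∈ nhds x₀ := isOpen_Ioo.mem_nhds hx₀
  have hd0 : ∀ x ∈ Set.Ioo a b, HasDerivAt τ (deriv τ x) x := fun x hx => by
    have := ((hd 0 (by norm_num)) x hx).differentiableAt (isOpen_Ioo.mem_nhds hx)
    rw [iteratedDeriv_zero] at this
    exact this.hasDerivAt
  have hd1 : HasDerivAt (deriv τ) (iteratedDeriv 2 τ x₀) x₀ := by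
    have := ((hd 1 (by norm_num)) x₀ hx₀).differentiableAt hnhds
    rw [iteratedDeriv_one] at this
    have h2 := this.hasDerivAt
    rwa [← congrFun (congrArg deriv (iteratedDeriv_one (f := τ))) x₀, ← iteratedDeriv_succ] at h2
  set T := iteratedDeriv 2 τ x₀
  have hlo := hasDerivAt_iff_isLittleO_nhds_zero.1 hd1
  -- The two remainders, at `y` and at `-y`, each contribute half of `η`.
  have hev := hlo.def (half_pos hη)
  obtain ⟨δ₁, hδ₁, h1⟩ := Metric.eventually_nhds_iff.1 hev
  obtain ⟨δ₂, hδ₂, h2⟩ := Metric.mem_nhds_iff.1 hnhds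
  refine ⟨min δ₁ δ₂ / 2, by positivity, fun t ht => ?_⟩
  have hsmall : ∀ y ∈ Set.uIcc 0 t, |y| ≤ |t| := fun y hy => by
    rcases Set.mem_uIcc.1 hy with h | h
    · rw [abs_of_nonneg h.1, abs_of_nonneg (h.1.trans h.2)]; exact h.2
    · rw [abs_of_nonpos h.2, abs_of_nonpos (h.1.trans h.2)]; linarith
  have hm1 := min_le_left δ₁ δ₂
  have hm2 := min_le_right δ₁ δ₂
  have hlt : min δ₁ δ₂ / 2 < min δ₁ δ₂ := half_lt_self (by positivity)
  have hball : ∀ y : ℝ, |y| ≤ |t| → x₀ + y ∈ Set.Ioo a b := fun y hy => by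
    apply h2
    rw [Metric.mem_ball, Real.dist_eq]
    simp only [add_sub_cancel_left]
    linarith
  have key := (convex_uIcc (0 : ℝ) t).norm_image_sub_le_of_norm_hasDerivWithin_le
    (f := fun y => τ (x₀ + y) + τ (x₀ - y) - y ^ 2 * T)
    (f' := fun y => deriv τ (x₀ + y) - deriv τ (x₀ - y) - 2 * y * T) (C := η * |t|)
    (x := 0) (y := t) ?_ ?_ Set.left_mem_uIcc Set.right_mem_uIcc
  · simp only [add_zero, sub_zero, Real.norm_eq_abs] at key
    calc _ = |τ (x₀ + t) + τ (x₀ - t) - t ^ 2 * T - (τ x₀ + τ x₀ - 0 ^ 2 * T)| := by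
          congr 1; ring
      _ ≤ η * |t| * |t| := key
      _ = η * t ^ 2 := by rw [mul_assoc, ← sq, sq_abs]
  · intro y hy
    have hp := (hd0 _ (hball y (hsmall y hy))).comp_const_add x₀ y
    have hm := HasDerivAt.comp_const_sub (f := τ) x₀ y
      (hd0 _ (hball (-y) (by rw [abs_neg]; exact hsmall y hy)))
    have hs := (hasDerivAt_pow 2 y).mul_const T
    refine HasDerivAt.hasDerivWithinAt (((hp.add hm).sub hs).congr_deriv ?_)
    simp [sub_eq_add_neg]
  · intro y hy
    have hy' := hsmall y hy
    have e1 := h1 (y := y) (by rw [Real.dist_eq, sub_zero]; linarith)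
    have e2 := h1 (y := -y) (by rw [Real.dist_eq, sub_zero, abs_neg]; linarith)
    simp only [smul_eq_mul, Real.norm_eq_abs, abs_neg] at e1 e2 ⊢
    have e3 : η * |y| ≤ η * |t| := by gcongr
    calc _ = |(deriv τ (x₀ + y) - deriv τ x₀ - y * T) -
          (deriv τ (x₀ + -y) - deriv τ x₀ - -y * T)| := by congr 1; ring_nf
      _ ≤ _ := (abs_sub _ _).trans (add_le_add e1 e2)
      _ ≤ _ := by linarith

theorem IsAdmissibleActivation.shallowApprox_sq (hτ : IsAdmissibleActivation τ) :
    ShallowApprox τ 2 fun x => x ^ 2 := by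
  intro M ε hε
  obtain ⟨x₀, a, b, hx₀, hd, hT⟩ := hτ.smooth
  set T := iteratedDeriv 2 τ x₀ with hTdef
  have hT' : 0 < |T| := abs_pos.2 hT
  have hM : 0 < M ^ 2 + 1 := by positivity
  -- With this `η`, division by `s ^ 2 * |T|` leaves the error `ε * x ^ 2 / (M ^ 2 + 1)`. The scale
  -- `s` below brings `s * x` into the range `|t| ≤ δ`.
  obtain ⟨δ, hδ, h⟩ := exists_second_difference hx₀ hd (η := ε * |T| / (M ^ 2 + 1)) (by positivity)
  set s := δ / (|M| + 1) with hs
  have hs0 : 0 < s := by positivity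
  refine ⟨![s, -s], ![x₀, x₀], fun _ => 1 / (s ^ 2 * T), -2 * τ x₀ / (s ^ 2 * T), fun x hx => ?_⟩
  have hx' : |x| ≤ |M| := hx.trans (le_abs_self M)
  have h1 := h (s * x) (by
    rw [abs_mul, abs_of_pos hs0, hs, div_mul_eq_mul_div, div_le_iff₀ (by positivity)]
    exact mul_le_mul_of_nonneg_left (by linarith) hδ.le)
  rw [← hTdef] at h1
  have e1 : -2 * τ x₀ / (s ^ 2 * T) +
      ∑ q : Fin 2, 1 / (s ^ 2 * T) * τ (![s, -s] q * x + ![x₀, x₀] q) - x ^ 2 =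
      (τ (x₀ + s * x) + τ (x₀ - s * x) - 2 * τ x₀ - (s * x) ^ 2 * T) / (s ^ 2 * T) := by
    simp only [Fin.sum_univ_two, Matrix.cons_val_zero, Matrix.cons_val_one]
    rw [show s * x + x₀ = x₀ + s * x by ring, show -s * x + x₀ = x₀ - s * x by ring]
    field_simp
    ring
  have hxM : x ^ 2 ≤ M ^ 2 + 1 := by
    have := sq_le_sq.2 hx'
    linarith
  rw [e1, abs_div, abs_mul, abs_of_pos (pow_pos hs0 2), div_le_iff₀ (by positivity)]
  refine h1.trans ?_
  rw [div_mul_eq_mul_div, div_le_iff₀ hM]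
  calc ε * |T| * (s * x) ^ 2 = ε * (s ^ 2 * |T|) * x ^ 2 := by ring
    _ ≤ _ := by gcongr

theorem NetApprox.pointwise [Fintype α] {N : ℕ} {g : ℝ → ℝ} (hg : ShallowApprox τ N g)
    (hgc : Continuous g) :
    NetApprox τ (2 * (Fintype.card α * Fintype.card (α × Fin N) * 9 +
      (Fintype.card α + Fintype.card (α × Fin N))))
      fun (x : α → Node n → ℝ) a i => g (x a i) := by
  classical
  refine ⟨by fun_prop, fun M ε hε c c' eα eβ => ?_⟩
  have hc : Fintype.card α = c := by simpa using Fintype.card_congr eα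
  have hc' : Fintype.card α = c' := by simpa using Fintype.card_congr eβ
  obtain ⟨w, z, v, z₀, h⟩ := hg M ε hε
  let e := Fintype.equivFin (α × Fin N)
  refine ⟨.comp (.affine (.ofKernel (.same n)
      (fun o q s => if s = 0 then (if (e.symm q).1 = eβ.symm o then v (e.symm q).2 else 0) else 0)
      fun _ => z₀))
    (.activated (.ofKernel (.same n)
      (fun o q s => if s = 0 then (if q = eα (e.symm o).1 then w (e.symm o).2 else 0) else 0)
      fun o => z (e.symm o).2)), ?_, fun x hx b i => ?_⟩
  · simp only [CNN.weights, Conv.ofKernel_weights]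
    rw [← hc', ← hc]
    nlinarith
  · have hK : ∀ (t : ℝ) (s : ℤ × ℤ), s ∉ Finset.Icc (-1 : ℤ × ℤ) 1 → (if s = 0 then t else 0) = 0 := by
      intro t s hs
      rw [if_neg]
      rintro rfl
      exact hs (by decide)
    simp only [CNN.eval]
    rw [Conv.ofKernel_eval _ _ fun _ _ => hK _]
    simp only [Conv.ofKernel_eval _ _ fun _ _ => hK _, sum_same_offset]
    refine le_of_eq_of_le ?_ (h (x b i) (hx b i))
    congr 3
    rw [Equiv.sum_comp e.symm fun q => (if q.1 = eβ.symm (eβ b) then v q.2 else 0) *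
      τ (z q.2 + ∑ p, (if p = eα q.1 then w q.2 else 0) * x (eα.symm p) i), Fintype.sum_prod_type]
    simp [add_comm]

/-- Polarisation: `F * G = ((F + G) / 2) ^ 2 - ((G - F) / 2) ^ 2`. -/
theorem NetApprox.mul [Fintype α] [Fintype β] (hτ : IsAdmissibleActivation τ) {W₁ W₂ : ℕ}
    {F G : (α → Node n → ℝ) → β → Node n → ℝ} (hF : NetApprox τ W₁ F) (hG : NetApprox τ W₂ G) :
    NetApprox τ (10000 * (W₁ + W₂ + (Fintype.card α + Fintype.card β + 1) ^ 2))
      fun x b i => F x b i * G x b i := by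
  have hsq : ∀ s : ℝ, NetApprox τ _ fun x b i => (s * F x b i + (1 / 2) * G x b i) ^ 2 := fun s =>
    (NetApprox.pointwise hτ.shallowApprox_sq (by fun_prop)).comp (hF.linComb hG s (1 / 2))
  refine (((hsq (1 / 2)).linComb (hsq (-1 / 2)) 1 (-1)).congr ?_).mono ?_
  · intro x b i
    ring
  · simp only [Fintype.card_sum, Fintype.card_prod, Fintype.card_fin]
    generalize Fintype.card α = a
    generalize Fintype.card β = b
    nlinarith [Nat.zero_le (a * b), Nat.zero_le W₁, Nat.zero_le W₂]

/-- This rests on `max F G = max (F - G) 0 + G`. -/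
theorem NetApprox.sup [Fintype α] [Fintype β] (hτ : IsAdmissibleActivation τ) {W₁ W₂ : ℕ}
    {F G : (α → Node n → ℝ) → β → Node n → ℝ} (hF : NetApprox τ W₁ F) (hG : NetApprox τ W₂ G) :
    NetApprox τ (10000 * (W₁ + W₂ + (Fintype.card α + Fintype.card β + 1) ^ 2))
      fun x b i => max (F x b i) (G x b i) := by
  have h := (NetApprox.pointwise hτ.shallowApprox_max (by fun_prop)).comp (hF.linComb hG 1 (-1))
  refine ((h.linComb hG 1 1).congr ?_).mono ?_
  · intro x b i
    simp only [one_mul, neg_mul]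
    rw [← max_add_add_right]
    simp
  · simp only [Fintype.card_sum, Fintype.card_prod, Fintype.card_fin]
    generalize Fintype.card α = a
    generalize Fintype.card β = b
    nlinarith [Nat.zero_le (a * b), Nat.zero_le W₁, Nat.zero_le W₂]

theorem NetApprox.iterate [Fintype α] {W : ℕ} {F : (α → Node n → ℝ) → α → Node n → ℝ}
    (hF : NetApprox τ W F) (k : ℕ) :
    NetApprox τ (k * W + (Fintype.card α * Fintype.card α * 9 + Fintype.card α)) F^[k] := by
  induction k with
  -- The identity also costs a convolution, which accounts for the summand without `k`.
  | zero => exact (NetApprox.reindex (τ := τ) (n := n) (id : α → α)).mono (by simp)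
  | succ k ih =>
    refine ((hF.comp ih).congr ?_).mono (by linarith)
    intro x b i
    rw [Function.iterate_succ_apply']

theorem NetApprox.exists_finset_sup' [Fintype α] (hτ : IsAdmissibleActivation τ) (s : Finset α)
    (hs : s.Nonempty) : ∃ W, ∀ n, NetApprox τ W fun (x : α → Node n → ℝ) (_ : Unit) i =>
      s.sup' hs fun a => x a i := by
  induction hs using Finset.Nonempty.cons_induction with
  | singleton a => exact ⟨_, fun n => NetApprox.reindex (n := n) fun _ : Unit => a⟩
  | cons a s ha hs ih =>
    obtain ⟨W, hW⟩ := ih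
    refine ⟨_, fun n => (((NetApprox.reindex (n := n) fun _ : Unit => a).sup hτ (hW n)).congr ?_)⟩
    intro x b i
    rw [Finset.sup'_cons hs]

/-! ### Stencil matrices and the Galerkin product -/

theorem offset₂_same (j i : Node n) : (Sampling.same n).offset₂ j i =
    (((j.1 : ℕ) : ℤ) - ((i.1 : ℕ) : ℤ), ((j.2 : ℕ) : ℤ) - ((i.2 : ℕ) : ℤ)) := rfl

theorem offset₂_down (j : Node (2 * n + 1)) (i : Node n) : (Sampling.down n).offset₂ j i =
    (((j.1 : ℕ) : ℤ) - (2 * ((i.1 : ℕ) : ℤ) + 1), ((j.2 : ℕ) : ℤ) - (2 * ((i.2 : ℕ) : ℤ) + 1)) := rfl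

theorem offset₂_up (j : Node n) (i : Node (2 * n + 1)) :
    (Sampling.up n).offset₂ j i = (Sampling.down n).offset₂ i j := rfl

/-- The matrix with nine-point stencils `a`: the entry `a d i` couples the pixel `i` to `i + d`. -/
def stencilMatrix (a : Dir → Node n → ℝ) : Matrix (Node n) (Node n) ℝ := Matrix.of fun i j =>
  ∑ d : Dir, if (Sampling.same n).offset₂ j i = d then a d i else 0

/-- The inner sum is a shift of `u` with zero padding, so applying the operator amounts to nine
pointwise products of channels. -/
theorem stencilMatrix_mulVec (a : Dir → Node n → ℝ) (u : Node n → ℝ) (i : Node n) :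
    (stencilMatrix a).mulVec u i =
      ∑ d : Dir, a d i * ∑ j, (if (Sampling.same n).offset₂ j i = d then 1 else 0) * u j := by
  simp only [Matrix.mulVec, dotProduct, stencilMatrix, Matrix.of_apply, Finset.sum_mul,
    Finset.mul_sum]
  rw [Finset.sum_comm]
  refine Finset.sum_congr rfl fun d _ => Finset.sum_congr rfl fun j _ => ?_
  split_ifs <;> simp

/-- The coefficients of a coarse hat function at the fine nodes. -/
def prolongationKernel (s : ℤ × ℤ) : ℝ := refHat ((s.1 : ℝ) / 2) ((s.2 : ℝ) / 2)

theorem refHat_eq_zero {s t : ℝ} (h : 1 ≤ max |s| |t|) : refHat s t = 0 := by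
  rw [refHat, max_eq_left]
  linarith [le_max_left (max |s| |t|) |s - t|]

theorem prolongationKernel_eq_zero (s : ℤ × ℤ) (hs : s ∉ Finset.Icc (-1 : ℤ × ℤ) 1) :
    prolongationKernel s = 0 := by
  apply refHat_eq_zero
  rw [le_max_iff, abs_div, abs_div, abs_two, one_le_div two_pos, one_le_div two_pos]
  by_contra! h
  apply hs
  have h1 : |s.1| < 2 := by exact_mod_cast h.1
  have h2 : |s.2| < 2 := by exact_mod_cast h.2
  rw [abs_lt] at h1 h2
  rw [mem_Icc_iff]
  omega

theorem prolongation_apply (j : Node (2 * n + 1)) (i : Node n) :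
    prolongation n j i = prolongationKernel ((Sampling.down n).offset₂ j i) := by
  rw [offset₂_down]
  simp only [prolongation, Matrix.of_apply, hat, node, prolongationKernel]
  have h : (n : ℝ) + 1 ≠ 0 := by positivity
  have h' : 2 * (n : ℝ) + 1 + 1 ≠ 0 := by positivity
  congr 1 <;>
  · simp
    field_simp
    ring

/-- The stencils of the Galerkin product. -/
def galerkin (a : Dir → Node (2 * n + 1) → ℝ) : Dir → Node n → ℝ := fun D i =>
  ∑ d : Dir, ∑ j, prolongationKernel ((Sampling.down n).offset₂ j i) *
    prolongationKernel ((Sampling.down n).offset₂ j i + d - D - D) * a d j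

/-- Only the fine pixel `j + d` contributes, and moving the coarse reference point from `i` to `i'`
changes fine offsets by `2 * (i' - i)`. -/
theorem sum_offset_prolongationKernel (j : Node (2 * n + 1)) (i i' : Node n) (d : ℤ × ℤ) :
    ∑ j', (if (Sampling.same (2 * n + 1)).offset₂ j' j = d then
      prolongationKernel ((Sampling.down n).offset₂ j' i') else 0) =
    prolongationKernel ((Sampling.down n).offset₂ j i + d -
      (Sampling.same n).offset₂ i' i - (Sampling.same n).offset₂ i' i) := by
  have e : (Sampling.down n).offset₂ j i + d - (Sampling.same n).offset₂ i' i - (Sampling.same n).offset₂ i' i =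
      (((j.1 : ℕ) : ℤ) + d.1 - (2 * ((i'.1 : ℕ) : ℤ) + 1),
        ((j.2 : ℕ) : ℤ) + d.2 - (2 * ((i'.2 : ℕ) : ℤ) + 1)) := by
    rw [offset₂_down, offset₂_same]
    ext <;> simp <;> ring
  rw [e]
  by_cases h : ∃ j₀, (Sampling.same (2 * n + 1)).offset₂ j₀ j = d
  · obtain ⟨j₀, rfl⟩ := h
    rw [Finset.sum_eq_single j₀]
    · rw [if_pos rfl, offset₂_down, offset₂_same]
      congr 2 <;> simp
    · intro j' _ hj'
      rw [if_neg]
      intro h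
      apply hj'
      simp only [offset₂_same, Prod.mk.injEq] at h
      ext <;> omega
    · simp
  · rw [Finset.sum_eq_zero fun j' _ => if_neg fun h' => h ⟨j', h'⟩]
    -- If `j + d` is off the grid, the kernel must vanish there: all pixels within one of `2 * i' +
    -- 1` lie between `0` and `2 * n`. Thus zero padding loses nothing at the boundary.
    rw [prolongationKernel_eq_zero]
    intro hmem
    rw [mem_Icc_iff] at hmem
    simp only at hmem
    have h1 := i'.1.2
    have h2 := i'.2.2
    refine h ⟨(⟨(((j.1 : ℕ) : ℤ) + d.1).toNat, by omega⟩,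
      ⟨(((j.2 : ℕ) : ℤ) + d.2).toNat, by omega⟩), ?_⟩
    rw [offset₂_same]
    ext <;> simp <;> omega

/-- Nine-point stencils are preserved because a nonzero term has two fine offsets and `d` all of
size at most one. Then `2 * (i' - i)` has size at most three, so `i' - i` has size at most one. -/
theorem galerkin_product (a : Dir → Node (2 * n + 1) → ℝ) :
    (prolongation n).transpose * stencilMatrix a * prolongation n = stencilMatrix (galerkin a) := by
  ext i i'
  have hL : ((prolongation n).transpose * stencilMatrix a * prolongation n) i i' =
      ∑ d : Dir, ∑ j, prolongationKernel ((Sampling.down n).offset₂ j i) *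
        prolongationKernel ((Sampling.down n).offset₂ j i + d -
          (Sampling.same n).offset₂ i' i - (Sampling.same n).offset₂ i' i) * a d j := by
    rw [Matrix.mul_assoc, Matrix.mul_apply, Finset.sum_comm]
    refine Finset.sum_congr rfl fun j _ => ?_
    rw [Matrix.mul_apply]
    simp only [Matrix.transpose_apply, prolongation_apply, stencilMatrix, Matrix.of_apply,
      Finset.sum_mul]
    rw [Finset.sum_comm, Finset.mul_sum]
    refine Finset.sum_congr rfl fun d _ => ?_
    rw [← sum_offset_prolongationKernel, mul_assoc, Finset.sum_mul]
    congr 1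
    refine Finset.sum_congr rfl fun j' _ => ?_
    split_ifs <;> ring
  rw [hL]
  simp only [stencilMatrix, Matrix.of_apply, galerkin]
  by_cases h : (Sampling.same n).offset₂ i' i ∈ Finset.Icc (-1 : ℤ × ℤ) 1
  · rw [Finset.sum_eq_single (a := (⟨_, h⟩ : Dir)) (f := fun d : Dir => ite _ _ _)]
    · rw [if_pos rfl]
    · intro D _ hD
      rw [if_neg]
      intro h'
      exact hD (Subtype.ext h'.symm)
    · simp
  · rw [Finset.sum_eq_zero, Finset.sum_eq_zero]
    · intro D _
      rw [if_neg]
      intro h'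
      exact h (h' ▸ D.2)
    · intro d _
      refine Finset.sum_eq_zero fun j _ => ?_
      by_contra hne
      have h1 : (Sampling.down n).offset₂ j i ∈ Finset.Icc (-1 : ℤ × ℤ) 1 := by
        by_contra hh
        exact hne (by rw [prolongationKernel_eq_zero _ hh]; ring)
      have h2 : (Sampling.down n).offset₂ j i + d - (Sampling.same n).offset₂ i' i - (Sampling.same n).offset₂ i' i ∈
          Finset.Icc (-1 : ℤ × ℤ) 1 := by
        by_contra hh
        exact hne (by rw [prolongationKernel_eq_zero _ hh]; ring)
      have h3 := d.2
      apply h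
      rw [mem_Icc_iff] at *
      simp only [Prod.fst_sub, Prod.fst_add, Prod.snd_sub, Prod.snd_add] at *
      omega

/-! ### The monotone restriction as a maximum over nine directions -/

/-- The positions at which the support of the fine hat function lies in that of the coarse one. -/
def supportDir (s : ℤ × ℤ) : Prop :=
  tsupport (fun x : ℝ × ℝ => refHat (2 * x.1 - s.1) (2 * x.2 - s.2)) ⊆
    tsupport fun x : ℝ × ℝ => refHat x.1 x.2

/-- The affine change of variables that maps the support of a hat function to the reference one. -/
def hatCoord (n : ℕ) (i : Node n) : EuclideanSpace ℝ (Fin 2) ≃ₜ ℝ × ℝ where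
  toFun x := (((n : ℝ) + 1) * x 0 - (((i.1 : ℕ) : ℝ) + 1), ((n : ℝ) + 1) * x 1 - (((i.2 : ℕ) : ℝ) + 1))
  invFun y := !₂[(y.1 + (((i.1 : ℕ) : ℝ) + 1)) / ((n : ℝ) + 1), (y.2 + (((i.2 : ℕ) : ℝ) + 1)) / ((n : ℝ) + 1)]
  left_inv x := by
    have h : (n : ℝ) + 1 ≠ 0 := by positivity
    ext k
    fin_cases k <;> simp <;> field_simp
  right_inv y := by
    have h : (n : ℝ) + 1 ≠ 0 := by positivity
    ext <;> simp <;> field_simp <;> ring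
  continuous_toFun := by fun_prop
  continuous_invFun := by fun_prop

theorem hatCoord_apply (i : Node n) (x : EuclideanSpace ℝ (Fin 2)) : hatCoord n i x =
    (((n : ℝ) + 1) * x 0 - (((i.1 : ℕ) : ℝ) + 1), ((n : ℝ) + 1) * x 1 - (((i.2 : ℕ) : ℝ) + 1)) := rfl

/-- In the coordinates of the coarse hat function the inclusion depends only on the relative
position, so the same directions are admissible at every pixel. -/
theorem tsupport_hat_subset_iff (j : Node (2 * n + 1)) (i : Node n) :
    tsupport (hat (2 * n + 1) j) ⊆ tsupport (hat n i) ↔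
      supportDir ((Sampling.down n).offset₂ j i) := by
  have e1 : hat n i = (fun x : ℝ × ℝ => refHat x.1 x.2) ∘ hatCoord n i := rfl
  have e2 : hat (2 * n + 1) j = (fun x : ℝ × ℝ => refHat
      (2 * x.1 - ((Sampling.down n).offset₂ j i).1) (2 * x.2 - ((Sampling.down n).offset₂ j i).2)) ∘
      hatCoord n i := by
    funext x
    simp only [hat, hatCoord_apply, offset₂_down, Function.comp_apply]
    congr 1 <;> push_cast <;> ring
  rw [e1, e2, tsupport_comp_eq_preimage, tsupport_comp_eq_preimage, supportDir,
    Set.preimage_subset_preimage_iff]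
  rw [(hatCoord n i).surjective.range_eq]
  exact Set.subset_univ _

theorem supportDir_zero : supportDir 0 := by
  refine closure_mono fun x hx => ?_
  simp only [Function.mem_support, refHat, ne_eq] at hx ⊢
  intro h
  apply hx
  rw [max_eq_left_iff] at h ⊢
  simp only [Prod.fst_zero, Prod.snd_zero, Int.cast_zero, sub_zero, ← mul_sub, abs_mul, abs_two]
  rw [← mul_max_of_nonneg _ _ zero_le_two, ← mul_max_of_nonneg _ _ zero_le_two]
  linarith

theorem abs_le_one_of_mem_tsupport {x : ℝ × ℝ} (hx : x ∈ tsupport fun x : ℝ × ℝ => refHat x.1 x.2) :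
    |x.1| ≤ 1 ∧ |x.2| ≤ 1 := by
  have hcl : IsClosed {x : ℝ × ℝ | |x.1| ≤ 1 ∧ |x.2| ≤ 1} :=
    (isClosed_le (continuous_fst.abs) continuous_const).inter
      (isClosed_le (continuous_snd.abs) continuous_const)
  refine closure_minimal (fun y hy => ?_) hcl hx
  by_contra hn
  refine hy (refHat_eq_zero ?_)
  simp only [Set.mem_ofPred_eq, not_and_or, not_le] at hn
  rw [le_max_iff]
  exact hn.imp le_of_lt le_of_lt

theorem refHat_pos_of_small {e : ℝ} (he : |e| < 1) : refHat e 0 ≠ 0 ∧ refHat 0 e ≠ 0 := by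
  simp only [refHat, sub_zero, zero_sub, abs_neg, abs_zero]
  rw [max_eq_left (abs_nonneg e), max_eq_right (abs_nonneg e), max_self,
    max_eq_right (by linarith)]
  constructor <;> linarith

/-- The fine support contains the points at `(s ± 1/2) / 2` along each axis through its centre. They
must lie within distance one of the origin, which gives `|s| ≤ 3/2` in each coordinate. -/
theorem supportDir_mem {s : ℤ × ℤ} (hs : supportDir s) : s ∈ Finset.Icc (-1 : ℤ × ℤ) 1 := by
  have key : ∀ e : ℝ, |e| < 1 → (|((s.1 : ℝ) + e) / 2| ≤ 1 ∧ |((s.2 : ℝ) + e) / 2| ≤ 1) := by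
    intro e he
    have h1 := abs_le_one_of_mem_tsupport (hs (subset_closure
      (show (((s.1 : ℝ) + e) / 2, (s.2 : ℝ) / 2) ∈ Function.support _ by
        simp only [Function.mem_support]
        ring_nf
        exact (refHat_pos_of_small he).1)))
    have h2 := abs_le_one_of_mem_tsupport (hs (subset_closure
      (show ((s.1 : ℝ) / 2, ((s.2 : ℝ) + e) / 2) ∈ Function.support _ by
        simp only [Function.mem_support]
        ring_nf
        exact (refHat_pos_of_small he).2)))
    exact ⟨h1.1, h2.2⟩
  have k1 := key (1 / 2) (by norm_num [abs_lt])
  have k2 := key (-1 / 2) (by norm_num [abs_lt])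
  simp only [abs_le] at k1 k2
  rw [mem_Icc_iff]
  refine ⟨⟨?_, ?_⟩, ?_, ?_⟩ <;> rw [← Int.lt_add_one_iff] <;>
  · have : ∀ z w : ℤ, (z : ℝ) < w → z < w := fun z w => by exact_mod_cast id
    apply this
    push_cast
    linarith [k1.1.1, k1.1.2, k1.2.1, k1.2.2, k2.1.1, k2.1.2, k2.2.1, k2.2.2]

open Classical in
/-- The direction `d` if it is admissible in the monotone restriction, and `0` otherwise. -/
def supportDirOrZero (d : Dir) : ℤ × ℤ := if supportDir d then d else 0

theorem supportDir_supportDirOrZero (d : Dir) : supportDir (supportDirOrZero d) := by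
  unfold supportDirOrZero
  split_ifs with h
  · exact h
  · exact supportDir_zero

theorem exists_offset₂_down_eq (i : Node n) {s : ℤ × ℤ} (hs : s ∈ Finset.Icc (-1 : ℤ × ℤ) 1) :
    ∃ j, (Sampling.down n).offset₂ j i = s := by
  rw [mem_Icc_iff] at hs
  have h1 := i.1.2
  have h2 := i.2.2
  refine ⟨(⟨(s.1 + (2 * ((i.1 : ℕ) : ℤ) + 1)).toNat, by omega⟩,
    ⟨(s.2 + (2 * ((i.2 : ℕ) : ℤ) + 1)).toNat, by omega⟩), ?_⟩
  rw [offset₂_down]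
  ext <;> simp <;> omega

theorem offset₂_down_injective (i : Node n) :
    Function.Injective fun j => (Sampling.down n).offset₂ j i := by
  intro j j' h
  simp only [offset₂_down, Prod.mk.injEq] at h
  ext <;> omega

theorem sum_offset₂_down (i : Node n) (v : Node (2 * n + 1) → ℝ) (j : Node (2 * n + 1)) {s : ℤ × ℤ}
    (hj : (Sampling.down n).offset₂ j i = s) :
    ∑ j', (if (Sampling.down n).offset₂ j' i = s then 1 else 0) * v j' = v j := by
  rw [Finset.sum_eq_single j]
  · simp [hj]
  · intro j' _ hne
    rw [if_neg, zero_mul]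
    exact fun h => hne (offset₂_down_injective i (h.trans hj.symm))
  · simp

theorem univ_dir_nonempty : (Finset.univ : Finset Dir).Nonempty := ⟨⟨0, by decide⟩, Finset.mem_univ _⟩

/-- Replacing inadmissible directions by the zero direction, which is admissible, does not change
the maximum. The admissible set thus need not be determined explicitly. -/
theorem monotoneRestriction_eq_sup' (v : Node (2 * n + 1) → ℝ) (i : Node n) :
    monotoneRestriction n v i = Finset.univ.sup' univ_dir_nonempty fun d : Dir =>
      ∑ j, (if (Sampling.down n).offset₂ j i = supportDirOrZero d then 1 else 0) * v j := by
  -- Nonemptiness makes the real supremum a genuine maximum and not the default value `0`.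
  have : Nonempty {j : Node (2 * n + 1) // tsupport (hat (2 * n + 1) j) ⊆ tsupport (hat n i)} := by
    obtain ⟨j, hj⟩ := exists_offset₂_down_eq i (supportDir_mem supportDir_zero)
    exact ⟨j, (tsupport_hat_subset_iff j i).2 (hj ▸ supportDir_zero)⟩
  apply le_antisymm
  · refine ciSup_le fun ⟨j, hj⟩ => ?_
    have hs := (tsupport_hat_subset_iff j i).1 hj
    refine le_of_eq_of_le ?_ (Finset.le_sup' _ (Finset.mem_univ (⟨_, supportDir_mem hs⟩ : Dir)))
    rw [sum_offset₂_down i v j]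
    simp [supportDirOrZero, hs]
  · refine Finset.sup'_le _ _ fun d _ => ?_
    have hs := supportDir_supportDirOrZero d
    obtain ⟨j, hj⟩ := exists_offset₂_down_eq i (supportDir_mem hs)
    rw [sum_offset₂_down i v j hj]
    exact le_ciSup (f := fun j : {j : Node (2 * n + 1) //
      tsupport (hat (2 * n + 1) j) ⊆ tsupport (hat n i)} => v j) (Set.finite_range _).bddAbove
      ⟨j, (tsupport_hat_subset_iff j i).2 (hj ▸ hs)⟩

/-! ### Hat functions of arbitrary grid points -/

/-- The hat function of an arbitrary point of the grid, in the indexing of the inner nodes. -/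
def gridHat (n : ℕ) (k : ℤ × ℤ) (x : EuclideanSpace ℝ (Fin 2)) : ℝ :=
  refHat (((n : ℝ) + 1) * x 0 - ((k.1 : ℝ) + 1)) (((n : ℝ) + 1) * x 1 - ((k.2 : ℝ) + 1))

/-- The grid point of an inner node. -/
def gridPoint (i : Node n) : ℤ × ℤ := (((i.1 : ℕ) : ℤ), ((i.2 : ℕ) : ℤ))

theorem hat_eq_gridHat (i : Node n) : hat n i = gridHat n (gridPoint i) := by
  funext x
  simp [hat, gridHat, gridPoint]

theorem refHat_nonneg (s t : ℝ) : 0 ≤ refHat s t := le_max_left _ _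

theorem refHat_le_one (s t : ℝ) : refHat s t ≤ 1 := by
  refine max_le zero_le_one ?_
  linarith [(abs_nonneg (s - t)).trans (le_max_right (max |s| |t|) |s - t|)]

theorem abs_gridHat_le (n : ℕ) (k : ℤ × ℤ) (x : EuclideanSpace ℝ (Fin 2)) : |gridHat n k x| ≤ 1 := by
  rw [gridHat, abs_of_nonneg (refHat_nonneg _ _)]
  exact refHat_le_one _ _

theorem gridHat_ne_zero {k : ℤ × ℤ} {x : EuclideanSpace ℝ (Fin 2)} (h : gridHat n k x ≠ 0) :
    |((n : ℝ) + 1) * x 0 - ((k.1 : ℝ) + 1)| < 1 ∧ |((n : ℝ) + 1) * x 1 - ((k.2 : ℝ) + 1)| < 1 := by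
  rw [← max_lt_iff]
  by_contra! hn
  exact h (refHat_eq_zero hn)

theorem sub_mem_Icc_of_gridHat_ne_zero {k l : ℤ × ℤ} {x : EuclideanSpace ℝ (Fin 2)}
    (hk : gridHat n k x ≠ 0) (hl : gridHat n l x ≠ 0) : k - l ∈ Finset.Icc (-1 : ℤ × ℤ) 1 := by
  obtain ⟨h1, h2⟩ := gridHat_ne_zero hk
  obtain ⟨h3, h4⟩ := gridHat_ne_zero hl
  rw [abs_lt] at h1 h2 h3 h4
  have e1 : ((k.1 - l.1 : ℤ) : ℝ) < 2 := by push_cast; linarith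
  have e2 : (-2 : ℝ) < ((k.1 - l.1 : ℤ) : ℝ) := by push_cast; linarith
  have e3 : ((k.2 - l.2 : ℤ) : ℝ) < 2 := by push_cast; linarith
  have e4 : (-2 : ℝ) < ((k.2 - l.2 : ℤ) : ℝ) := by push_cast; linarith
  rw [mem_Icc_iff, Prod.fst_sub, Prod.snd_sub]
  have f1 : k.1 - l.1 < 2 := by exact_mod_cast e1
  have f2 : -2 < k.1 - l.1 := by exact_mod_cast e2
  have f3 : k.2 - l.2 < 2 := by exact_mod_cast e3
  have f4 : -2 < k.2 - l.2 := by exact_mod_cast e4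
  omega

theorem mem_unitSquare_of_gridHat_ne_zero {i : Node n} {x : EuclideanSpace ℝ (Fin 2)}
    (h : gridHat n (gridPoint i) x ≠ 0) : x ∈ unitSquare := by
  obtain ⟨h1, h2⟩ := gridHat_ne_zero h
  have hn : (0 : ℝ) < n + 1 := by positivity
  have key : ∀ (m : Fin n) (y : ℝ), |((n : ℝ) + 1) * y - ((((m : ℕ) : ℤ) : ℝ) + 1)| < 1 →
      y ∈ Set.Ioo (0 : ℝ) 1 := by
    intro m y hy
    rw [abs_lt] at hy
    push_cast at hy
    have h0 : (0 : ℝ) ≤ (m : ℕ) := by positivity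
    have h1 : ((m : ℕ) : ℝ) + 1 ≤ n := by exact_mod_cast m.2
    constructor <;> nlinarith
  intro k
  fin_cases k
  · exact key _ _ h1
  · exact key _ _ h2

theorem exists_lipschitzWith_gridHat (n : ℕ) :
    ∃ L, ∀ k, LipschitzWith L (gridHat n k) := by
  have h0 : ∀ (q : Fin 2), ∃ L, ∀ c : ℝ,
      LipschitzWith L fun x : EuclideanSpace ℝ (Fin 2) => ((n : ℝ) + 1) * x q - c := fun q =>
    ⟨_, fun c => ((((n : ℝ) + 1) • (EuclideanSpace.proj q :
      EuclideanSpace ℝ (Fin 2) →L[ℝ] ℝ)).lipschitz).sub (LipschitzWith.const c)⟩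
  obtain ⟨L₀, hL₀⟩ := h0 0
  obtain ⟨L₁, hL₁⟩ := h0 1
  refine ⟨_, fun k => LipschitzWith.const_max (((LipschitzWith.const (1 : ℝ)).sub
    (LipschitzWith.max (LipschitzWith.max (lipschitzWith_one_norm.comp (hL₀ ((k.1 : ℝ) + 1)))
      (lipschitzWith_one_norm.comp (hL₁ ((k.2 : ℝ) + 1))))
      (lipschitzWith_one_norm.comp ((hL₀ ((k.1 : ℝ) + 1)).sub (hL₁ ((k.2 : ℝ) + 1))))))) 0⟩

theorem norm_gradient_le_of_lipschitz {f : EuclideanSpace ℝ (Fin 2) → ℝ} {L : NNReal}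
    (hf : LipschitzWith L f) (x : EuclideanSpace ℝ (Fin 2)) : ‖gradient f x‖ ≤ L := by
  rw [gradient, LinearIsometryEquiv.norm_map]
  exact norm_fderiv_le_of_lipschitz ℝ hf

theorem measurable_gradient (f : EuclideanSpace ℝ (Fin 2) → ℝ) : Measurable (gradient f) := by
  unfold gradient
  exact (LinearIsometryEquiv.continuous _).measurable.comp (measurable_fderiv ℝ f)

/-- A zero of a nonnegative function is a minimum, where `fderiv` vanishes even if the function has
a kink. No case distinction over triangles is needed. -/
theorem gradient_gridHat_eq_zero {k : ℤ × ℤ} {x : EuclideanSpace ℝ (Fin 2)}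
    (h : gridHat n k x = 0) : gradient (gridHat n k) x = 0 := by
  have : IsLocalMin (gridHat n k) x := Filter.Eventually.of_forall fun y => by
    rw [h]
    exact refHat_nonneg _ _
  rw [gradient, this.fderiv_eq_zero, map_zero]

/-! ### Translation invariance of the stiffness matrix -/

/-- The integrand of the entries of the stiffness matrix. -/
def tripleIntegrand (n : ℕ) (i j k : ℤ × ℤ) (x : EuclideanSpace ℝ (Fin 2)) : ℝ :=
  gridHat n j x * inner ℝ (gradient (gridHat n i) x) (gradient (gridHat n k) x)

theorem tripleIntegrand_eq_zero {i j k : ℤ × ℤ} {x : EuclideanSpace ℝ (Fin 2)}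
    (h : gridHat n i x = 0 ∨ gridHat n j x = 0 ∨ gridHat n k x = 0) :
    tripleIntegrand n i j k x = 0 := by
  rw [tripleIntegrand]
  rcases h with h | h | h
  · rw [gradient_gridHat_eq_zero h, inner_zero_left, mul_zero]
  · rw [h, zero_mul]
  · rw [gradient_gridHat_eq_zero h, inner_zero_right, mul_zero]

theorem tripleIntegrand_add (i j k t : ℤ × ℤ) : ∃ v, ∀ x,
    tripleIntegrand n (i + t) (j + t) (k + t) x = tripleIntegrand n i j k (x - v) := by
  refine ⟨!₂[(t.1 : ℝ) / ((n : ℝ) + 1), (t.2 : ℝ) / ((n : ℝ) + 1)], fun x => ?_⟩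
  set v : EuclideanSpace ℝ (Fin 2) := !₂[(t.1 : ℝ) / ((n : ℝ) + 1), (t.2 : ℝ) / ((n : ℝ) + 1)]
    with hv
  have h : ∀ l : ℤ × ℤ, gridHat n (l + t) = fun x => gridHat n l (x - v) := by
    intro l
    funext y
    have hn : (n : ℝ) + 1 ≠ 0 := by positivity
    simp only [gridHat]
    congr 1 <;>
    · simp [hv]
      field_simp
      ring
  have hg : ∀ l : ℤ × ℤ, gradient (gridHat n (l + t)) x = gradient (gridHat n l) (x - v) := by
    intro l
    rw [h l, gradient, gradient, fderiv_comp_sub]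
  rw [tripleIntegrand, tripleIntegrand, hg, hg, h j]

theorem integral_tripleIntegrand (i j k : ℤ × ℤ) :
    ∫ x, tripleIntegrand n i j k x = ∫ x, tripleIntegrand n 0 (j - i) (k - i) x := by
  obtain ⟨v, hv⟩ := tripleIntegrand_add (n := n) 0 (j - i) (k - i) i
  rw [zero_add, sub_add_cancel, sub_add_cancel] at hv
  simp_rw [hv]
  exact integral_sub_right_eq_self _ v

theorem isBounded_unitSquare : Bornology.IsBounded unitSquare := by
  rw [isBounded_iff_forall_norm_le]
  refine ⟨√2, fun x hx => ?_⟩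
  rw [EuclideanSpace.norm_eq]
  apply Real.sqrt_le_sqrt
  have h0 := hx 0
  have h1 := hx 1
  simp only [Fin.sum_univ_two, Real.norm_eq_abs, sq_abs]
  nlinarith [h0.1, h0.2, h1.1, h1.2]

theorem volume_unitSquare_lt_top : volume unitSquare < ⊤ := isBounded_unitSquare.measure_lt_top

theorem integrableOn_tripleIntegrand (i j k : ℤ × ℤ) :
    IntegrableOn (tripleIntegrand n i j k) unitSquare := by
  obtain ⟨L, hL⟩ := exists_lipschitzWith_gridHat n
  refine Measure.integrableOn_of_bounded (M := 1 * (L * L)) volume_unitSquare_lt_top.ne ?_ ?_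
  · exact ((hL j).continuous.measurable.mul ((measurable_gradient _).inner
      (measurable_gradient _))).aestronglyMeasurable
  · refine Filter.Eventually.of_forall fun x => ?_
    rw [tripleIntegrand, norm_mul]
    exact mul_le_mul (abs_gridHat_le _ _ _) ((norm_inner_le_norm _ _).trans
      (mul_le_mul (norm_gradient_le_of_lipschitz (hL i) x) (norm_gradient_le_of_lipschitz (hL k) x)
        (norm_nonneg _) L.2)) (norm_nonneg _) zero_le_one

/-- The kernel of the convolution that maps the coefficient to the stencils of the stiffness
matrix. -/
def stiffnessKernel (n : ℕ) (d e : ℤ × ℤ) : ℝ := ∫ x, tripleIntegrand n 0 e d x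

theorem stiffnessKernel_eq_zero {d e : ℤ × ℤ}
    (h : d ∉ Finset.Icc (-1 : ℤ × ℤ) 1 ∨ e ∉ Finset.Icc (-1 : ℤ × ℤ) 1) :
    stiffnessKernel n d e = 0 := by
  rw [stiffnessKernel, integral_eq_zero_of_ae]
  refine Filter.Eventually.of_forall fun x => ?_
  apply tripleIntegrand_eq_zero
  by_contra! hn
  obtain ⟨h0, h1, h2⟩ := hn
  have e1 := sub_mem_Icc_of_gridHat_ne_zero h1 h0
  have e2 := sub_mem_Icc_of_gridHat_ne_zero h2 h0
  rw [sub_zero] at e1 e2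
  tauto

/-- The stencils of the stiffness matrix. -/
def stiffnessStencil (n : ℕ) (κ : Node n → ℝ) : Dir → Node n → ℝ := fun d i =>
  ∑ j, stiffnessKernel n d ((Sampling.same n).offset₂ j i) * κ j

/-- The hat function of the inner node `i` vanishes outside `D`, so each integral extends to the
whole plane. There it is invariant under grid translations, also for nodes next to the boundary. -/
theorem stiffness_eq_stencilMatrix (κ : Node n → ℝ) :
    stiffness n κ = stencilMatrix (stiffnessStencil n κ) := by
  ext i k
  have h1 : stiffness n κ i k = ∑ j, stiffnessKernel n ((Sampling.same n).offset₂ k i)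
      ((Sampling.same n).offset₂ j i) * κ j := by
    have e : ∀ x, feFun n κ x * inner ℝ (gradient (hat n i) x) (gradient (hat n k) x) =
        ∑ j, κ j * tripleIntegrand n (gridPoint i) (gridPoint j) (gridPoint k) x := by
      intro x
      simp only [feFun, Finset.sum_mul, hat_eq_gridHat, tripleIntegrand, mul_assoc]
    simp only [stiffness, Matrix.of_apply, e]
    rw [integral_finsetSum _ fun j _ => (integrableOn_tripleIntegrand _ _ _).const_mul (κ j)]
    refine Finset.sum_congr rfl fun j _ => ?_
    rw [integral_const_mul, setIntegral_eq_integral_of_forall_compl_eq_zero,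
      integral_tripleIntegrand, mul_comm]
    · rfl
    · intro x hx
      apply tripleIntegrand_eq_zero
      left
      by_contra h
      exact hx (mem_unitSquare_of_gridHat_ne_zero h)
  rw [h1, stencilMatrix, Matrix.of_apply]
  by_cases h : (Sampling.same n).offset₂ k i ∈ Finset.Icc (-1 : ℤ × ℤ) 1
  · rw [Finset.sum_eq_single (a := (⟨_, h⟩ : Dir)) (f := fun d : Dir => ite _ _ _)]
    · rw [if_pos rfl]
      rfl
    · intro D _ hD
      rw [if_neg]
      intro h'
      exact hD (Subtype.ext h'.symm)
    · simp
  · rw [Finset.sum_eq_zero, Finset.sum_eq_zero]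
    · intro D _
      rw [if_neg]
      intro h'
      exact h (h' ▸ D.2)
    · intro j _
      rw [stiffnessKernel_eq_zero (Or.inl h), zero_mul]

/-! ### Coefficients control the norm of `H¹` -/

/-- Crude bounds suffice: with `N` nodes, the function is at most `N * δ` and Lipschitz with
constant `N * L * δ`. -/
theorem exists_h1Norm_le (n : ℕ) : ∃ K : ℝ, 0 ≤ K ∧ ∀ (δ : ℝ) (v : Node n → ℝ), 0 ≤ δ →
    (∀ i, |v i| ≤ δ) → h1Norm n v ≤ K * δ := by
  obtain ⟨L, hL⟩ := exists_lipschitzWith_gridHat n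
  obtain ⟨N, hN⟩ : ∃ N : ℝ, N = (Fintype.card (Node n) : ℝ) := ⟨_, rfl⟩
  have hN0 : 0 ≤ N := hN ▸ Nat.cast_nonneg _
  set V : ℝ := volume.real unitSquare with hV
  have hV0 : 0 ≤ V := measureReal_nonneg
  refine ⟨√(V * (N ^ 2 + (N * L) ^ 2)), Real.sqrt_nonneg _, fun δ v hδ hv => ?_⟩
  have h1 : ∀ x, |feFun n v x| ≤ N * δ := by
    intro x
    calc |feFun n v x| ≤ ∑ i, |v i * hat n i x| := Finset.abs_sum_le_sum_abs _ _
      _ ≤ ∑ i : Node n, δ := Finset.sum_le_sum fun i _ => by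
        rw [abs_mul, hat_eq_gridHat]
        calc _ ≤ δ * 1 := mul_le_mul (hv i) (abs_gridHat_le _ _ _) (abs_nonneg _) hδ
          _ = δ := mul_one δ
      _ = N * δ := by simp [hN]
  have h2 : LipschitzWith (Real.toNNReal (N * L * δ)) (feFun n v) := by
    refine LipschitzWith.of_dist_le_mul fun x y => ?_
    rw [Real.coe_toNNReal _ (by positivity), Real.dist_eq, feFun, feFun, ← Finset.sum_sub_distrib]
    calc _ ≤ ∑ i, |v i * hat n i x - v i * hat n i y| := Finset.abs_sum_le_sum_abs _ _
      _ ≤ ∑ i : Node n, δ * (L * dist x y) := Finset.sum_le_sum fun i _ => by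
        rw [← mul_sub, abs_mul, hat_eq_gridHat]
        exact mul_le_mul (hv i) ((hL _).dist_le_mul x y) (abs_nonneg _) hδ
      _ = N * L * δ * dist x y := by
        simp only [Finset.sum_const, Finset.card_univ, nsmul_eq_mul, ← hN]
        ring
  have h3 : ∀ x, ‖gradient (feFun n v) x‖ ≤ N * L * δ := fun x => by
    have := norm_gradient_le_of_lipschitz h2 x
    rwa [Real.coe_toNNReal _ (by positivity)] at this
  have i1 := norm_setIntegral_le_of_norm_le_const (f := fun x => feFun n v x ^ 2)
    volume_unitSquare_lt_top (C := (N * δ) ^ 2) fun x _ => by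
      rw [norm_pow]
      exact pow_le_pow_left₀ (norm_nonneg _) (h1 x) 2
  have i2 := norm_setIntegral_le_of_norm_le_const (f := fun x => ‖gradient (feFun n v) x‖ ^ 2)
    volume_unitSquare_lt_top (C := (N * L * δ) ^ 2) fun x _ => by
      rw [norm_pow, norm_norm]
      exact pow_le_pow_left₀ (norm_nonneg _) (h3 x) 2
  rw [h1Norm, Real.sqrt_le_left (by positivity), mul_pow, Real.sq_sqrt (by positivity)]
  calc _ ≤ _ := add_le_add ((Real.le_norm_self _).trans i1) ((Real.le_norm_self _).trans i2)
    _ = _ := by rw [← hV]; ring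

/-! ### Convolutions without bias -/

/-- `F` is a convolution without bias, with kernels of width three. -/
def IsConv [Fintype α] (S : Sampling n n') (F : (α → Node n → ℝ) → β → Node n' → ℝ) : Prop :=
  ∃ K : β → α → ℤ × ℤ → ℝ, (∀ b a s, s ∉ Finset.Icc (-1 : ℤ × ℤ) 1 → K b a s = 0) ∧
    ∀ x b i, F x b i = ∑ a, ∑ j, K b a (S.offset₂ j i) * x a j

theorem IsConv.netApprox [Fintype α] [Fintype β] {S : Sampling n n'}
    {F : (α → Node n → ℝ) → β → Node n' → ℝ} (hF : IsConv S F) :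
    NetApprox τ (Fintype.card β * Fintype.card α * 9 + Fintype.card β) F := by
  obtain ⟨K, hK, h⟩ := hF
  refine (NetApprox.conv S K hK 0).congr fun x b i => ?_
  rw [h, Pi.zero_apply, zero_add]

theorem IsConv.sumElim [Fintype α] {S : Sampling n n'} {F : (α → Node n → ℝ) → β → Node n' → ℝ}
    {G : (α → Node n → ℝ) → γ → Node n' → ℝ} (hF : IsConv S F) (hG : IsConv S G) :
    IsConv S fun x => Sum.elim (F x) (G x) := by
  obtain ⟨K, hK, h⟩ := hF
  obtain ⟨K', hK', h'⟩ := hG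
  refine ⟨Sum.elim K K', ?_, ?_⟩
  · rintro (b | b)
    · exact hK b
    · exact hK' b
  · rintro x (b | b) i
    · exact h x b i
    · exact h' x b i

theorem IsConv.single [Fintype α] (S : Sampling n n') (a : α) (K : β → ℤ × ℤ → ℝ)
    (hK : ∀ b s, s ∉ Finset.Icc (-1 : ℤ × ℤ) 1 → K b s = 0) :
    IsConv S fun (x : α → Node n → ℝ) b i => ∑ j, K b (S.offset₂ j i) * x a j := by
  classical
  refine ⟨fun b a' s => if a' = a then K b s else 0, fun b a' s hs => ?_, fun x b i => ?_⟩
  · simp only [hK b s hs, ite_self]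
  · rw [Finset.sum_eq_single a]
    · simp
    · intro a' _ h
      simp [h]
    · simp

theorem indicator_kernel_eq_zero {d s : ℤ × ℤ} (hd : d ∈ Finset.Icc (-1 : ℤ × ℤ) 1)
    (hs : s ∉ Finset.Icc (-1 : ℤ × ℤ) 1) : (if s = d then (1 : ℝ) else 0) = 0 := by
  rw [if_neg]
  rintro rfl
  exact hs hd

theorem NetApprox.reindexOption [Fintype α] [Fintype β] (g : β → Option α) :
    NetApprox τ (Fintype.card β * Fintype.card α * 9 + Fintype.card β)
      fun (x : α → Node n → ℝ) b i => (g b).elim 0 fun a => x a i := by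
  classical
  refine (NetApprox.pointwiseLinear (fun b a => if g b = some a then 1 else 0) 0).congr ?_
  intro x b i
  cases g b <;> simp

theorem card_dir : Fintype.card Dir = 9 := by
  rw [Fintype.card_coe]
  rfl

/-! ### The state of the algorithm -/

/-- The channels of the state of the algorithm: the iterate, the right-hand side, the obstacle, and
the stencils of the operator. -/
abbrev Channel : Type := Fin 3 ⊕ Dir

/-- The operator stored in a state. -/
def stateMatrix (x : Channel → Node n → ℝ) : Matrix (Node n) (Node n) ℝ :=
  stencilMatrix fun d => x (Sum.inr d)

/-- Replacement of the iterate. -/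
def withIterate (x : Channel → Node n → ℝ) (v : Node n → ℝ) : Channel → Node n → ℝ :=
  Function.update x (Sum.inl 0) v

@[simp] theorem withIterate_inl_zero (x : Channel → Node n → ℝ) (v : Node n → ℝ) :
    withIterate x v (Sum.inl 0) = v := by simp [withIterate]

@[simp] theorem withIterate_inl_one (x : Channel → Node n → ℝ) (v : Node n → ℝ) :
    withIterate x v (Sum.inl 1) = x (Sum.inl 1) := by simp [withIterate]

@[simp] theorem withIterate_inl_two (x : Channel → Node n → ℝ) (v : Node n → ℝ) :
    withIterate x v (Sum.inl 2) = x (Sum.inl 2) := by simp [withIterate]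

@[simp] theorem withIterate_inr (x : Channel → Node n → ℝ) (v : Node n → ℝ) (d : Dir) :
    withIterate x v (Sum.inr d) = x (Sum.inr d) := by simp [withIterate]

@[simp] theorem stateMatrix_withIterate (x : Channel → Node n → ℝ) (v : Node n → ℝ) :
    stateMatrix (withIterate x v) = stateMatrix x := by simp [stateMatrix]

@[simp] theorem withIterate_withIterate (x : Channel → Node n → ℝ) (v w : Node n → ℝ) :
    withIterate (withIterate x v) w = withIterate x w := by simp [withIterate]

/-- `T` takes its data only from the channels that the update leaves alone, so these data stay fixed
during the iteration. -/
theorem iterate_withIterate (T : (Channel → Node n → ℝ) → (Node n → ℝ) → Node n → ℝ)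
    (hT : ∀ x v, T (withIterate x v) = T x) (k : ℕ) (x : Channel → Node n → ℝ) :
    (fun x => withIterate x (T x (x (Sum.inl 0))))^[k] x =
      withIterate x ((T x)^[k] (x (Sum.inl 0))) := by
  induction k with
  | zero => simp [withIterate]
  | succ k ih =>
    rw [Function.iterate_succ_apply', ih, Function.iterate_succ_apply', hT]
    simp

/-- The overhead is additive and chosen before `n` and `W`, as the recursion over levels requires.
-/
theorem exists_netApprox_withIterate : ∃ W₀, ∀ (τ : ℝ → ℝ) (n W : ℕ)
    (G : (Channel → Node n → ℝ) → Unit → Node n → ℝ), NetApprox τ W G →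
      NetApprox τ (W₀ + W) fun x => withIterate x (G x ()) := by
  refine ⟨_, fun τ n W G hG => ((((NetApprox.reindex (τ := τ) (n := n) (α := Channel ⊕ Unit)
    fun c : Channel => if c = Sum.inl 0 then Sum.inr () else Sum.inl c).comp hG.skip).congr
    ?_).mono (by rw [← Nat.add_assoc]))⟩
  intro x c i
  simp only [withIterate, Function.update_apply]
  split_ifs <;> rfl

theorem exists_netApprox_mulVec (hτ : IsAdmissibleActivation τ) :
    ∃ W, ∀ n, NetApprox τ W fun (x : Channel → Node n → ℝ) (_ : Unit) =>
      (stateMatrix x).mulVec (x (Sum.inl 0)) := by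
  refine ⟨_, fun n => (((NetApprox.pointwiseLinear (fun (_ : Unit) (_ : Dir) => 1) 0).comp
    ((NetApprox.reindex (n := n) fun d : Dir => (Sum.inr d : Channel)).mul hτ
      (IsConv.single (.same n) (Sum.inl 0 : Channel) (fun (d : Dir) s => if s = d then 1 else 0)
        fun d s hs => indicator_kernel_eq_zero d.2 hs).netApprox)).congr ?_)⟩
  intro x b i
  rw [stateMatrix, stencilMatrix_mulVec]
  simp

/-- A smoothing step on states. -/
def smoothState (ω : ℝ) (x : Channel → Node n → ℝ) : Channel → Node n → ℝ :=
  withIterate x (richardson ω (stateMatrix x) (x (Sum.inl 1)) (x (Sum.inl 2)) (x (Sum.inl 0)))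

theorem exists_netApprox_smoothState (hτ : IsAdmissibleActivation τ) :
    ∃ W, ∀ n ω, NetApprox τ W (smoothState (n := n) ω) := by
  obtain ⟨W₀, h₀⟩ := exists_netApprox_withIterate
  obtain ⟨W, hW⟩ := exists_netApprox_mulVec hτ
  have hc : ∀ (c : Channel) (n : ℕ), NetApprox τ _ fun x (_ : Unit) => x c :=
    fun c n => NetApprox.reindex (n := n) fun _ => c
  refine ⟨_, fun n ω => h₀ τ n _ (fun x _ => richardson ω (stateMatrix x) (x (Sum.inl 1))
    (x (Sum.inl 2)) (x (Sum.inl 0))) ((((((hc (Sum.inl 0) n).linComb (hc (Sum.inl 1) n) 1 ω).linComb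
    (hW n) 1 (-ω)).sup hτ (hc (Sum.inl 2) n))).congr ?_)⟩
  intro x b i
  simp only [richardson]
  congr 1
  ring

theorem smoothState_iterate (ω : ℝ) (k : ℕ) (x : Channel → Node n → ℝ) :
    (smoothState ω)^[k] x = withIterate x
      ((richardson ω (stateMatrix x) (x (Sum.inl 1)) (x (Sum.inl 2)))^[k] (x (Sum.inl 0))) :=
  iterate_withIterate (fun x => richardson ω (stateMatrix x) (x (Sum.inl 1)) (x (Sum.inl 2)))
    (by simp) k x

/-- The coarse problem for the correction. -/
def restrictState (x : Channel → Node (2 * n + 1) → ℝ) : Channel → Node n → ℝ :=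
  Sum.elim ![0, (prolongation n).transpose.mulVec
      (x (Sum.inl 1) - (stateMatrix x).mulVec (x (Sum.inl 0))),
    monotoneRestriction n (x (Sum.inl 2) - x (Sum.inl 0))] (galerkin fun d => x (Sum.inr d))

theorem isConv_galerkin : IsConv (.down n) fun (x : (Unit ⊕ Unit) ⊕ Dir → Node (2 * n + 1) → ℝ) =>
    galerkin fun d => x (Sum.inr d) := by
  refine ⟨fun D => Sum.elim 0 fun d s => prolongationKernel s * prolongationKernel (s + d - D - D),
    ?_, ?_⟩
  · rintro D (a | d) s hs
    · rfl
    · simp only [Sum.elim_inr, prolongationKernel_eq_zero s hs, zero_mul]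
  · intro x D i
    simp [galerkin]

theorem exists_netApprox_restrictState (hτ : IsAdmissibleActivation τ) :
    ∃ W, ∀ n, NetApprox τ W (restrictState (n := n)) := by
  obtain ⟨W, hW⟩ := exists_netApprox_mulVec hτ
  obtain ⟨W', hW'⟩ := NetApprox.exists_finset_sup' hτ (Finset.univ : Finset Dir) univ_dir_nonempty
  have hc : ∀ (c : Channel) (n : ℕ), NetApprox τ _ fun x (_ : Unit) => x c :=
    fun c n => NetApprox.reindex (n := n) fun _ => c
  have hfine := fun n => (((hc (Sum.inl 1) n).linComb (hW n) 1 (-1)).pair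
    ((hc (Sum.inl 2) n).linComb (hc (Sum.inl 0) n) 1 (-1))).pair
      (NetApprox.reindex (n := n) fun d : Dir => (Sum.inr d : Channel))
  -- One two-strided convolution yields the restricted residual, the nine samples for the monotone
  -- restriction, and the Galerkin stencils.
  have hdown := fun n => ((IsConv.single (.down n) (Sum.inl (Sum.inl ()) : (Unit ⊕ Unit) ⊕ Dir)
    (fun (_ : Unit) s => prolongationKernel s) fun _ => prolongationKernel_eq_zero).sumElim
    (IsConv.single (.down n) (Sum.inl (Sum.inr ()) : (Unit ⊕ Unit) ⊕ Dir)
      (fun (d : Dir) s => if s = supportDirOrZero d then 1 else 0) fun d _ hs =>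
        indicator_kernel_eq_zero (supportDir_mem (supportDir_supportDirOrZero d)) hs)).sumElim
    isConv_galerkin
  -- The maximum is taken on the coarse grid. The entry `none` supplies the zero initial guess.
  have hcoarse := fun n => (NetApprox.reindexOption (τ := τ) (n := n)
    (α := ((Unit ⊕ Dir) ⊕ Dir) ⊕ Unit) (β := Channel) (Sum.elim
      ![none, some (Sum.inl (Sum.inl (Sum.inl ()))), some (Sum.inr ())]
      fun d => some (Sum.inl (Sum.inr d)))).comp ((hW' n).comp (NetApprox.reindex (n := n)
        fun d : Dir => (Sum.inl (Sum.inr d) : (Unit ⊕ Dir) ⊕ Dir))).skip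
  refine ⟨_, fun n => ((hcoarse n).comp ((hdown n).netApprox.comp (hfine (2 * n + 1)))).congr ?_⟩
  rintro x (c | d) i
  · fin_cases c
    · simp [restrictState]
    · simp [restrictState, Matrix.mulVec, dotProduct, prolongation_apply, sub_eq_add_neg]
    · simp [restrictState, monotoneRestriction_eq_sup', sub_eq_add_neg]
  · simp [restrictState]

/-- A V-cycle on states. -/
def cycleState (n₁ k k₀ : ℕ) (ω : ℝ) (r : ℕ) (x : Channel → Node (side n₁ r) → ℝ) :
    Channel → Node (side n₁ r) → ℝ :=
  withIterate x (vcmr n₁ k k₀ ω r (stateMatrix x) (x (Sum.inl 1)) (x (Sum.inl 2)) (x (Sum.inl 0)))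

/-- The coarse grid correction on states, for a coarse solver `V`. -/
def correctState (V : (Channel → Node n → ℝ) → Channel → Node n → ℝ)
    (x : Channel → Node (2 * n + 1) → ℝ) : Channel → Node (2 * n + 1) → ℝ :=
  withIterate x (x (Sum.inl 0) + (prolongation n).mulVec (V (restrictState x) (Sum.inl 0)))

/-- The coarse solver must enter with factor one, since otherwise the count would grow exponentially
in the number of levels. It is therefore surrounded only by operations with additive cost, not by
`NetApprox.mul` or `NetApprox.sup`. -/
theorem exists_netApprox_correctState (hτ : IsAdmissibleActivation τ) :
    ∃ W₀, ∀ (n W : ℕ) (V : (Channel → Node n → ℝ) → Channel → Node n → ℝ), NetApprox τ W V →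
      NetApprox τ (W₀ + W) (correctState V) := by
  obtain ⟨W₀, h₀⟩ := exists_netApprox_withIterate
  obtain ⟨W₁, h₁⟩ := exists_netApprox_restrictState hτ
  have hup := fun n => (IsConv.single (.up n) (Sum.inl 0 : Channel)
    (fun (_ : Unit) s => prolongationKernel s) fun _ => prolongationKernel_eq_zero).netApprox (τ := τ)
  have hc := fun n => NetApprox.reindex (τ := τ) (n := n) fun _ : Unit => (Sum.inl 0 : Channel)
  refine ⟨W₀ + W₁ + 10000, fun n W V hV => (h₀ τ _ _ _ (((hc (2 * n + 1)).linComb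
    ((hup n).comp (hV.comp (h₁ n))) 1 1).congr (G := fun x _ => x (Sum.inl 0) +
      (prolongation n).mulVec (V (restrictState x) (Sum.inl 0))) ?_)).mono ?_⟩
  · intro x b i
    simp [Matrix.mulVec, dotProduct, prolongation_apply, offset₂_up]
  · simp only [Fintype.card_sum, Fintype.card_fin, Fintype.card_unit, card_dir]
    omega

theorem restrictState_apply (x : Channel → Node (2 * n + 1) → ℝ) :
    restrictState x (Sum.inl 0) = 0 ∧ restrictState x (Sum.inl 1) =
      (prolongation n).transpose.mulVec (x (Sum.inl 1) - (stateMatrix x).mulVec (x (Sum.inl 0))) ∧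
    restrictState x (Sum.inl 2) = monotoneRestriction n (x (Sum.inl 2) - x (Sum.inl 0)) ∧
    stateMatrix (restrictState x) =
      (prolongation n).transpose * stateMatrix x * prolongation n := by
  refine ⟨rfl, rfl, rfl, ?_⟩
  rw [stateMatrix, stateMatrix, galerkin_product]
  rfl

theorem cycleState_zero (n₁ k k₀ : ℕ) (ω : ℝ) : cycleState n₁ k k₀ ω 0 = (smoothState ω)^[k₀] := by
  funext x
  rw [smoothState_iterate]
  rfl

theorem cycleState_succ (n₁ k k₀ : ℕ) (ω : ℝ) (r : ℕ)
    (x : Channel → Node (2 * side n₁ r + 1) → ℝ) : cycleState n₁ k k₀ ω (r + 1) x =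
      (smoothState ω)^[k] (correctState (cycleState n₁ k k₀ ω r) ((smoothState ω)^[k] x)) := by
  obtain ⟨h0, h1, h2, h3⟩ := restrictState_apply ((smoothState ω)^[k] x)
  rw [smoothState_iterate ω k (correctState _ _)]
  simp only [correctState, cycleState, withIterate_inl_zero, withIterate_inl_one,
    withIterate_inl_two, stateMatrix_withIterate, withIterate_withIterate, h0, h1, h2, h3]
  simp only [smoothState_iterate, withIterate_inl_zero, withIterate_inl_one,
    withIterate_inl_two, stateMatrix_withIterate, withIterate_withIterate]
  rfl

theorem exists_netApprox_cycleState (hτ : IsAdmissibleActivation τ) :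
    ∃ W, ∀ (n₁ k k₀ : ℕ) (ω : ℝ) (r : ℕ), 1 ≤ k →
      NetApprox τ (W * (k * (r + 1) + k₀)) (cycleState n₁ k k₀ ω r) := by
  obtain ⟨Ws, hs⟩ := exists_netApprox_smoothState hτ
  obtain ⟨Wc, hc⟩ := exists_netApprox_correctState hτ
  set Wi := Fintype.card Channel * Fintype.card Channel * 9 + Fintype.card Channel
  -- A further level costs `2 * k * Ws + 2 * Wi + Wc`. Since `1 ≤ k`, this is at most `k` times the
  -- chosen constant.
  refine ⟨2 * Ws + 2 * Wi + Wc, fun n₁ k k₀ ω r hk => ?_⟩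
  induction r with
  | zero =>
    rw [cycleState_zero]
    refine ((hs _ ω).iterate k₀).mono ?_
    have h1 : Wi ≤ Wi * k := Nat.le_mul_of_pos_right _ hk
    change k₀ * Ws + Wi ≤ _
    nlinarith [Nat.zero_le (Ws * k), Nat.zero_le (Wc * k), Nat.zero_le (Ws * k₀),
      Nat.zero_le (Wi * k₀), Nat.zero_le (Wc * k₀)]
  | succ r ih =>
    have h := ((hs (2 * side n₁ r + 1) ω).iterate k).comp
      ((hc _ _ _ ih).comp ((hs (2 * side n₁ r + 1) ω).iterate k))
    refine (h.congr fun x b i => ?_).mono ?_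
    · rw [← cycleState_succ]
    · have h1 : Wi ≤ Wi * k := Nat.le_mul_of_pos_right _ hk
      have h2 : Wc ≤ Wc * k := Nat.le_mul_of_pos_right _ hk
      change k * Ws + Wi + (Wc + (2 * Ws + 2 * Wi + Wc) * (k * (r + 1) + k₀) + (k * Ws + Wi)) ≤ _
      nlinarith

theorem exists_netApprox_vcmrIter (hτ : IsAdmissibleActivation τ) :
    ∃ W, ∀ (n₁ k k₀ : ℕ) (ω : ℝ) (r m : ℕ), 1 ≤ k → 1 ≤ m →
      NetApprox τ (W * (m * (k * (r + 1) + k₀))) fun (x : Fin 4 → Node (side n₁ r) → ℝ) (_ : Fin 1) =>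
        vcmrIter n₁ k k₀ ω r m (x 0) (x 1) (x 2) (x 3) := by
  obtain ⟨W, hW⟩ := exists_netApprox_cycleState hτ
  -- The coefficient is converted into stencils once, before all cycles. The summand `20000` below
  -- pays for this, for the final channel selection and for the overhead of the iteration.
  have hinit := fun n => (NetApprox.reindex (τ := τ) (n := n) ![(0 : Fin 4), 2, 3]).pair
    (IsConv.single (.same n) (1 : Fin 4) (fun (d : Dir) s => stiffnessKernel n d s)
      fun d s hs => stiffnessKernel_eq_zero (Or.inr hs)).netApprox
  have hfin := fun n => NetApprox.reindex (τ := τ) (n := n) fun _ : Fin 1 => (Sum.inl 0 : Channel)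
  refine ⟨W + 20000, fun n₁ k k₀ ω r m hk hm => (((hfin _).comp
    (((hW n₁ k k₀ ω r hk).iterate m).comp (hinit _))).congr fun x b i => ?_).mono ?_⟩
  · have h := iterate_withIterate (fun x => vcmr n₁ k k₀ ω r (stateMatrix x) (x (Sum.inl 1))
      (x (Sum.inl 2))) (by simp) m (Sum.elim ![x 0, x 2, x 3] (stiffnessStencil _ (x 1)))
    rw [vcmrIter, stiffness_eq_stencilMatrix]
    have e : Sum.elim (fun b => x (![0, 2, 3] b)) (stiffnessStencil _ (x 1)) =
        Sum.elim ![x 0, x 2, x 3] (stiffnessStencil _ (x 1)) := by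
      congr 1
      funext c
      fin_cases c <;> rfl
    have h' := congrFun (congrFun h (Sum.inl 0)) i
    rw [withIterate_inl_zero, ← e] at h'
    exact h'.symm
  · have h1 : 1 ≤ m * (k * (r + 1) + k₀) := Nat.mul_pos hm (by positivity)
    simp only [Fintype.card_sum, Fintype.card_fin, card_dir]
    nlinarith

end ObstacleCNN

end

theorem mainTheorem3 (τ : ℝ → ℝ) (hτ : ObstacleCNN.IsAdmissibleActivation τ) :
    ∃ C : ℝ, 0 < C ∧
      ∀ (n₁ r : ℕ) (ω M ε : ℝ) (k k₀ m : ℕ), 0 < ω → 0 < M → 0 < ε → 1 ≤ k → 1 ≤ m →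
        ∃ Ψ : ObstacleCNN.CNN 4 (ObstacleCNN.side n₁ r) 1 (ObstacleCNN.side n₁ r),
          (∀ u₀ κ f φ : ObstacleCNN.Node (ObstacleCNN.side n₁ r) → ℝ,
            (∀ i, u₀ i ∈ Set.Icc (-M) M) → (∀ i, κ i ∈ Set.Icc (-M) M) →
            (∀ i, f i ∈ Set.Icc (-M) M) → (∀ i, φ i ∈ Set.Icc (-M) M) →
            ObstacleCNN.h1Norm (ObstacleCNN.side n₁ r)
              (Ψ.eval τ ![u₀, κ, f, φ] 0 - ObstacleCNN.vcmrIter n₁ k k₀ ω r m u₀ κ f φ) ≤ ε) ∧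
          (Ψ.weights : ℝ) ≤ C * (m : ℝ) * ((k : ℝ) * ((r : ℝ) + 1) + (k₀ : ℝ)) := by
  obtain ⟨W, hW⟩ := ObstacleCNN.exists_netApprox_vcmrIter hτ
  refine ⟨W + 1, by positivity, fun n₁ r ω M ε k k₀ m _ _ hε hk hm => ?_⟩
  obtain ⟨K, hK, hnorm⟩ := ObstacleCNN.exists_h1Norm_le (ObstacleCNN.side n₁ r)
  -- The constant `K` depends on the mesh but enters only the accuracy. Using `K + 1` avoids
  -- division by zero.
  obtain ⟨Ψ, hΨw, hΨ⟩ := (hW n₁ k k₀ ω r m hk hm).2 M (ε / (K + 1)) (by positivity)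
    (Equiv.refl _) (Equiv.refl _)
  refine ⟨Ψ, fun u₀ κ f φ h1 h2 h3 h4 => ?_, ?_⟩
  · have h := hΨ ![u₀, κ, f, φ] (by
      intro a i
      fin_cases a
      · exact abs_le.2 (h1 i)
      · exact abs_le.2 (h2 i)
      · exact abs_le.2 (h3 i)
      · exact abs_le.2 (h4 i)) 0
    refine (hnorm (ε / (K + 1)) _ (by positivity) h).trans ?_
    rw [← mul_div_assoc, div_le_iff₀ (by positivity)]
    nlinarith
  · calc (Ψ.weights : ℝ) ≤ ((W * (m * (k * (r + 1) + k₀)) : ℕ) : ℝ) := by exact_mod_cast hΨw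
      _ = W * m * (k * (r + 1) + k₀) := by push_cast; ring
      _ ≤ _ := by gcongr; linarith
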